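/- \textbf{Theorem (thinning of Poisson).} Let $E$ be a Dedekind complete Riesz space with weak order unit $e$, and let $T$ be a conditional expectation operator on $E$, that is, a strictly positive order continuous linear projection with $Te=e$ whose range $R(T)$ is a Dedekind complete Riesz subspace. Products of elements of $E$ are taken in the universal completion $E^u$ with its $f$-algebra multiplication with unit $e$, functions of an element of $E$ are taken in the (Daniell) functional calculus, and series converge in order. For $x,y\in E$ let $P_{x=y}=I-P_{|x-y|}$, where $P_z$ is the band projection onto the band generated by $z$, and let $\pi_x(t)=TP_{x=te}e$ $(t\in\mathbb R)$ be the mass function of $x$. Write $x\sim_T\mathcal B(p)$, where $p\in E$ and $0<p<e$ (that is, $0\le p\le e$, $p\ne 0$ and $p\neq e$), if $\pi_x(1)=p$ and $\pi_x(0)=e-p$. Write $x\sim_T\mathcal P(g)$, where $g\in E$ and $g\ge 0$, if $\pi_x(k)=\frac{g^k}{k!}\exp(-g)$ for $k=0,1,2,\dots$. A family $(f_i)_{i\in I}$ in $E$ is $T$-independent if $TP_{i_1}P_{i_2}\cdots P_{i_n}e=TP_{i_1}TP_{i_2}\cdots TP_{i_n}e$ for all distinct $i_1,\dots,i_n\in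 I$ and all band projections $P_i$ such that $P_ie$ lies in the order closed Riesz subspace generated by $f_i$ and $R(T)$. Suppose that $N\sim_T\mathcal P(g)$, that $x_i\sim_T\mathcal B(p)$ for all $i\ge 1$, and that the family $N,x_1,x_2,\dots$ is $T$-independent. Put $S_n=\sum_{i=1}^n x_i$. Then the series $S_N:=\sum_{n\ge 1}P_{N=ne}S_n$ converges in order in $E$, the product $pg$ belongs to $E$, and $S_N\sim_T\mathcal P(pg)$. -/

import Mathlib

/-!
Riesz spaces with a conditional expectation operator.  Throughout, a Dedekind complete Riesz
space is a real vector space with a compatible order that is a conditionally complete lattice.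
-/

noncomputable section

namespace RieszProb

variable {E : Type*} [ConditionallyCompleteLattice E] [AddCommGroup E] [IsOrderedAddMonoid E]
  [Module ℝ E] [IsOrderedModule ℝ E]

/-! ### Order convergence -/

/-- The sequence `s` converges in order to `l`: `|s n - l| ≤ y n` for some `y n ↓ 0`. -/
def OrderTendsto (s : ℕ → E) (l : E) : Prop :=
  ∃ y : ℕ → E, Antitone y ∧ IsGLB (Set.range y) 0 ∧ ∀ n, |s n - l| ≤ y n

/-- The series `∑ f n` (`n = 0, 1, 2, …`) converges in order to `s`. -/
def HasOrderSum (f : ℕ → E) (s : E) : Prop :=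
  OrderTendsto (fun m => ∑ n ∈ Finset.range m, f n) s

/-! ### Conditional Riesz triples -/

/-- `e` is a weak order unit. -/
def IsWeakOrderUnit (e : E) : Prop :=
  0 ≤ e ∧ ∀ x : E, |x| ⊓ e = 0 → x = 0

/-- `T` is a (strictly positive) conditional expectation operator on `E` with `T e = e`. -/
structure IsCondExp (e : E) (T : E →ₗ[ℝ] E) : Prop where
  nonneg : ∀ x : E, 0 ≤ x → 0 ≤ T x
  orderContinuous : ∀ D : Set E, D.Nonempty → DirectedOn (· ≥ ·) D → IsGLB D 0 →
    IsGLB (T '' D) 0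
  idem : ∀ x : E, T (T x) = T x
  map_unit : T e = e
  range_sup : ∀ x ∈ LinearMap.range T, ∀ y ∈ LinearMap.range T, x ⊔ y ∈ LinearMap.range T
  range_complete : ∀ A : Set E, A ⊆ LinearMap.range T → A.Nonempty →
    (∃ b ∈ LinearMap.range T, b ∈ upperBounds A) →
    ∃ s ∈ LinearMap.range T, s ∈ upperBounds A ∧
      ∀ b ∈ LinearMap.range T, b ∈ upperBounds A → s ≤ b
  strictlyPos : ∀ x : E, 0 < x → 0 < T x

/-- `(E, e, T)` is a conditional Riesz triple. -/
structure IsCondRieszTriple (e : E) (T : E →ₗ[ℝ] E) : Prop where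
  unit : IsWeakOrderUnit e
  condExp : IsCondExp e T

/-! ### Band projections -/

/-- The band projection `P_x` onto the band generated by `x`, evaluated at `y`: for `y ≥ 0` it is
`sup_n (y ∧ n|x|)`, and in general `P_x y = P_x y⁺ - P_x y⁻`. -/
def bandProj (x y : E) : E :=
  (⨆ n : ℕ, y⁺ ⊓ (n : ℝ) • |x|) - ⨆ n : ℕ, y⁻ ⊓ (n : ℝ) • |x|

/-- `P_{x = y}`, the complementary projection of `P_{|x - y|}`, evaluated at `z`. -/
def projEq (x y z : E) : E := z - bandProj |x - y| z

/-- A linear operator is a band projection (on some band of `E`): `P² = P` and `0 ≤ P ≤ I`. -/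
structure IsBandProjection (P : E →ₗ[ℝ] E) : Prop where
  idem : ∀ x : E, P (P x) = P x
  nonneg : ∀ x : E, 0 ≤ x → 0 ≤ P x
  le_self : ∀ x : E, 0 ≤ x → P x ≤ x

/-! ### Independence with respect to `T` -/

/-- A family of band projections is `T`-independent if
`T P_{i₁} P_{i₂} ⋯ P_{iₙ} e = T P_{i₁} T P_{i₂} ⋯ T P_{iₙ} e` for distinct `i₁, …, iₙ`.
(Products in `Module.End` are compositions of operators.) -/
def ProjIndep (e : E) (T : Module.End ℝ E) {ι : Type*} (P : ι → Module.End ℝ E) : Prop :=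
  ∀ l : List ι, l.Nodup → T ((l.map P).prod e) = (l.map fun i => T * P i).prod e

/-- `S` is an order closed Riesz subspace of `E`. -/
def IsClosedRieszSubspace (S : Submodule ℝ E) : Prop :=
  (∀ x ∈ S, ∀ y ∈ S, x ⊔ y ∈ S) ∧
    ∀ A : Set E, A ⊆ S → A.Nonempty → ∀ x : E, IsLUB A x → x ∈ S

/-- `⟨f, R(T)⟩`, the closed Riesz subspace generated by `f` and the range of `T`. -/
def genSubspace (T : E →ₗ[ℝ] E) (f : E) : Submodule ℝ E :=
  sInf {S | IsClosedRieszSubspace S ∧ f ∈ S ∧ LinearMap.range T ≤ S}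

/-- A family of subspaces is `T`-independent if all families of band projections `P i` with
`P i e` in the `i`-th subspace are `T`-independent. -/
def SubspaceIndep (e : E) (T : E →ₗ[ℝ] E) {ι : Type*} (F : ι → Submodule ℝ E) : Prop :=
  ∀ P : ι → (E →ₗ[ℝ] E), (∀ i, IsBandProjection (P i)) → (∀ i, P i e ∈ F i) → ProjIndep e T P

/-- A family of elements of `E` is `T`-independent. -/
def ElemIndep (e : E) (T : E →ₗ[ℝ] E) {ι : Type*} (f : ι → E) : Prop :=
  SubspaceIndep e T fun i => genSubspace T (f i)

/-! ### Functional calculus and products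

The products and functions below live in the universal completion `E^u`, with its `f`-algebra
multiplication whose unit is `e`. As `E` is an ideal of `E^u`, a supremum in `E` of elements of `E`
is also their supremum in `E^u`. -/

/-- The right continuous spectral system `e_t = P_{x ≤ te} e = (I - P_{(x - te)⁺}) e` of `x`. -/
def spectral (e x : E) (t : ℝ) : E := e - bandProj (x - t • e)⁺ e

/-- `w = f(x)` in the functional calculus of `x` (the Daniell integral of `f` with respect to the
spectral system of `x`), for a continuous function `f ≥ 0`: `w` is the supremum of the integrals
`α (e_b - e_a)` of the functions `α 1_{(a,b]}` lying below `f`, with `α ≥ 0`. (Integrals of disjoint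
such pieces are disjoint in `E`, so their sum is their supremum, and it makes no difference to
allow general step functions below `f`.) -/
def IsFunCalc (e x : E) (f : ℝ → ℝ) (w : E) : Prop :=
  IsLUB {y | ∃ a b α : ℝ, a < b ∧ 0 ≤ α ∧ (∀ t, a < t → t ≤ b → α ≤ f t) ∧
    y = α • (spectral e x b - spectral e x a)} w

/-- `c` is a component of `e`. -/
def IsComponent (e c : E) : Prop := c ⊓ (e - c) = 0

/-- For a finite family of positive elements `u i` of `E`: the product `∏ u i` in the `f`-algebra
`E^u` with unit `e` belongs to `E` and equals `w`. If `c` is a component of `e` and `a i • c ≤ u i`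
for all `i`, where `a i ≥ 0`, then `(∏ a i) • c ≤ ∏ u i`, because `c * c = c`; the product is the
supremum of these minorants. -/
def IsPosProd (e : E) {ι : Type*} [Fintype ι] (u : ι → E) (w : E) : Prop :=
  (∀ i, 0 ≤ u i) ∧
    IsLUB {y | ∃ (c : E) (a : ι → ℝ), IsComponent e c ∧ (∀ i, 0 ≤ a i ∧ a i • c ≤ u i) ∧
      y = (∏ i, a i) • c} w

/-! ### Distributions -/

/-- The `(T, e)`-mass function `π_x(t) = T P_{x = te} e`. -/
def massFn (e : E) (T : E →ₗ[ℝ] E) (x : E) (t : ℝ) : E := T (projEq x (t • e) e)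

/-- `x` has the Bernoulli distribution `B(p)` with respect to `T`, where `0 < p < e`. -/
def IsBernoulli (e : E) (T : E →ₗ[ℝ] E) (x p : E) : Prop :=
  0 < p ∧ p < e ∧ massFn e T x 1 = p ∧ massFn e T x 0 = e - p

/-- `x` has the Poisson distribution with parameter `g ≥ 0` with respect to `T`:
`π_x(k) = g^k / k! · exp(-g)` for `k = 0, 1, 2, …`, where `g^k · exp(-g)` is the product of `k`
factors `g` and one factor `h = exp(-g)`. -/
def IsPoisson (e : E) (T : E →ₗ[ℝ] E) (x g : E) : Prop :=
  0 ≤ g ∧ ∃ h : E, IsFunCalc e g (fun t => Real.exp (-t)) h ∧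
    ∀ k : ℕ, ∃ w : E, IsPosProd e (Fin.cons h fun _ : Fin k => g : Fin (k + 1) → E) w ∧
      massFn e T x (k : ℝ) = ((k.factorial : ℝ)⁻¹) • w

/-! ### Random sums -/

/-- `S` is the random sum `S_N = ∑ₙ P_{N = ne} Sₙ` (an order convergent series), where
`Sₙ = x₁ + ⋯ + xₙ`. The terms `x₁, x₂, …` are `x 0, x 1, …`; the term with `n = 0` vanishes. -/
def IsRandomSum (e N : E) (x : ℕ → E) (S : E) : Prop :=
  HasOrderSum (fun n : ℕ => projEq N ((n : ℝ) • e) (∑ i ∈ Finset.range n, x i)) S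

end RieszProb

end

noncomputable section

set_option linter.unusedSectionVars false

namespace RieszProb

open Filter Set

/-! ### Real identities -/

/-! The probabilistic argument is the classical one. Given `N = n`, the event `S_N = k` is the
union, over the `k`-element subsets `A` of the first `n` indices, of the events that exactly the
trials in `A` succeed. Independence turns the conditional expectation of each such event into
`π_N(n) p^k (e - p)^(n-k)`, and summing over `A` and `n` leaves a real power series identity
(`hasSum_thinned_poisson`).

The work lies in making sense of these products and sums in an abstract Riesz space. Instead of
representing `E` by functions, the proof evaluates its elements at generic points, in the manner of
forcing. A point is a decreasing sequence of strictly positive elements, and a property holds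
generically if it holds at all points meeting countably many suitable dense sets. As in the
Rasiowa–Sikorski lemma, such points exist below every `u > 0` (`exists_point_le`). With `e`
normalized to `1`, each element has a real value at generic points; the lattice and linear
operations are computed pointwise, inequalities are detected pointwise (`le_of_val_le`), and so are
countable suprema (`val_isLUB`). Band projections become multiplication by indicators, and products
and functional calculus become those of `ℝ` (`isPosProd_iff_val`, `isFunCalc_iff_val`).

The operator `T` is not pointwise. What is needed of it is order continuity, strict positivity and
the averaging identity `T (P y) = T (P e) * y` for a band projection `P` and `y ≥ 0` in the range
(`IsCondExp.val_map_mul`); with averaging, iterated operators `T P_i` become products of values.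
Strict positivity forces `x i` to take values in `{0, 1}` and `N` in `ℕ`, and
`IsCondExp.massFn_randomSum` then carries out the classical computation. -/

lemma hasSum_poisson (g : ℝ) :
    HasSum (fun n : ℕ => ((n.factorial : ℝ)⁻¹) * (Real.exp (-g) * g ^ n)) 1 := by
  have h := (NormedSpace.expSeries_div_hasSum_exp (𝔸 := ℝ) g).mul_left (Real.exp (-g))
  rw [← Real.exp_eq_exp_ℝ, ← Real.exp_add, neg_add_cancel, Real.exp_zero] at h
  refine h.congr_fun fun n => ?_
  ring

/-- The terms with `n < k` vanish. After a shift by `k`, `(n+k).choose k / (n+k)! = 1 / (k! n!)`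
leaves the exponential series of `(1 - p) g`, and `exp (-g) * exp ((1 - p) g) = exp (-(p g))`. -/
lemma hasSum_thinned_poisson (g p : ℝ) (k : ℕ) :
    HasSum (fun n : ℕ => (n.choose k : ℝ) * (p ^ k * (1 - p) ^ (n - k)) *
      (((n.factorial : ℝ)⁻¹) * (Real.exp (-g) * g ^ n)))
      (((k.factorial : ℝ)⁻¹) * (Real.exp (-(p * g)) * (p * g) ^ k)) := by
  rw [← hasSum_nat_add_iff' k, Finset.sum_eq_zero, sub_zero]
  · have h := (NormedSpace.expSeries_div_hasSum_exp (𝔸 := ℝ) ((1 - p) * g)).mul_left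
      (((k.factorial : ℝ)⁻¹) * (Real.exp (-g) * (p * g) ^ k))
    rw [← Real.exp_eq_exp_ℝ] at h
    have hval : ((k.factorial : ℝ)⁻¹) * (Real.exp (-(p * g)) * (p * g) ^ k) =
        ((k.factorial : ℝ)⁻¹) * (Real.exp (-g) * (p * g) ^ k) * Real.exp ((1 - p) * g) := by
      have h1 : Real.exp (-(p * g)) = Real.exp (-g) * Real.exp ((1 - p) * g) := by
        rw [← Real.exp_add]; congr 1; ring
      rw [h1]; ring
    rw [hval]
    refine h.congr_fun fun n => ?_
    have h1 : ((n + k).choose k : ℝ) * ((n + k).factorial : ℝ)⁻¹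
        = (k.factorial : ℝ)⁻¹ * (n.factorial : ℝ)⁻¹ := by
      have h2 : ((n + k).choose k : ℝ) * n.factorial * k.factorial = (n + k).factorial := by
        have := Nat.choose_mul_factorial_mul_factorial (Nat.le_add_left k n)
        rw [Nat.add_sub_cancel] at this
        rw [mul_right_comm]
        exact_mod_cast this
      have := Nat.factorial_ne_zero n
      have := Nat.factorial_ne_zero k
      rw [← h2]
      have h3 : ((n + k).choose k : ℝ) ≠ 0 := by
        exact_mod_cast (Nat.choose_pos (Nat.le_add_left k n)).ne'
      field_simp
    rw [Nat.add_sub_cancel]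
    calc _ = ((n + k).choose k : ℝ) * ((n + k).factorial : ℝ)⁻¹ * (p ^ k * (1 - p) ^ n *
          (Real.exp (-g) * g ^ (n + k))) := by ring
      _ = _ := by rw [h1, mul_pow, mul_pow]; ring
  · intro n hn
    rw [Nat.choose_eq_zero_of_lt (Finset.mem_range.1 hn)]
    simp

lemma list_prod_map_range (f : ℕ → ℝ) (n : ℕ) :
    ((List.range n).map f).prod = ∏ i ∈ Finset.range n, f i := rfl

/-- Each product is the indicator that `A` is the exact set of successes `B`, so at most one `A`
contributes, and one does precisely when `B` has `k` elements. -/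
lemma sum_powersetCard_prod_ite {ξ : ℕ → ℝ} (hξ : ∀ i, ξ i = 0 ∨ ξ i = 1) (n k : ℕ) :
    ∑ A ∈ Finset.powersetCard k (Finset.range n),
      ∏ i ∈ Finset.range n, (if ξ i = (if i ∈ A then 1 else 0) then (1 : ℝ) else 0) =
      if ∑ i ∈ Finset.range n, ξ i = k then 1 else 0 := by
  classical
  set B := (Finset.range n).filter fun i => ξ i = 1 with hB
  have hsum : ∑ i ∈ Finset.range n, ξ i = B.card := by
    rw [hB, Finset.card_filter, Nat.cast_sum]
    refine Finset.sum_congr rfl fun i _ => ?_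
    rcases hξ i with h | h <;> simp [h]
  have hprod : ∀ A ∈ Finset.powersetCard k (Finset.range n),
      ∏ i ∈ Finset.range n, (if ξ i = (if i ∈ A then 1 else 0) then (1 : ℝ) else 0) =
        if A = B then 1 else 0 := by
    intro A hA
    have hAr := (Finset.mem_powersetCard.1 hA).1
    rw [Finset.prod_ite_zero, Finset.prod_const_one]
    congr 1
    refine propext ⟨fun h => ?_, ?_⟩
    · ext i
      rw [hB, Finset.mem_filter]
      refine ⟨fun hi => ⟨hAr hi, by simpa [hi] using h i (hAr hi)⟩, fun ⟨hi, hi'⟩ => ?_⟩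
      by_contra hA'
      have := h i hi
      rw [if_neg hA', hi'] at this
      exact one_ne_zero this
    · rintro rfl i hi
      by_cases h : ξ i = 1
      · simp [hB, h, Finset.mem_range.1 hi]
      · have h0 := (hξ i).resolve_right h
        simp [hB, h0]
  rw [Finset.sum_congr rfl hprod, Finset.sum_ite_eq', hsum]
  congr 1
  simp [Finset.mem_powersetCard, hB]

variable {E : Type*} [ConditionallyCompleteLattice E] [AddCommGroup E] [IsOrderedAddMonoid E]
  [Module ℝ E] [IsOrderedModule ℝ E]

/-! ### Preliminaries on Riesz spaces -/

/-- Dedekind completeness implies the Archimedean property: the supremum `s` of the multiples of `x`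
satisfies `s ≤ s - x`. -/
lemma nonpos_of_forall_nsmul_le {x y : E} (h : ∀ n : ℕ, n • x ≤ y) : x ≤ 0 := by
  have hb : BddAbove (range fun n : ℕ => n • x) := ⟨y, by rintro _ ⟨n, rfl⟩; exact h n⟩
  have h1 : (⨆ n : ℕ, n • x) ≤ (⨆ n : ℕ, n • x) - x := ciSup_le fun n => by
    have := le_ciSup hb (n + 1)
    rw [le_sub_iff_add_le]
    simpa [succ_nsmul] using this
  simpa using h1

lemma nonpos_of_forall_le_smul {x y : E} (h : ∀ n : ℕ, x ≤ ((n : ℝ) + 1)⁻¹ • y) : x ≤ 0 := by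
  have hy : ∀ n : ℕ, (n + 1) • x ≤ y := fun n => by
    have hn : (0 : ℝ) < (n : ℝ) + 1 := by positivity
    have := smul_le_smul_of_nonneg_left (h n) hn.le
    rw [smul_smul, mul_inv_cancel₀ hn.ne', one_smul] at this
    rw [← Nat.cast_smul_eq_nsmul ℝ]
    simpa using this
  refine nonpos_of_forall_nsmul_le (y := |y|) fun n => ?_
  rcases n with _ | n
  · simp
  · exact (hy n).trans (le_abs_self y)

lemma add_inf_le {a b c : E} (ha : 0 ≤ a) (hb : 0 ≤ b) (hc : 0 ≤ c) :
    (a + b) ⊓ c ≤ a ⊓ c + b ⊓ c := by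
  have h1 : (a + b) ⊓ c - b ⊓ c ≤ a ⊓ c := by
    refine le_inf ?_ ?_
    · rw [sub_le_iff_le_add, ← sub_le_iff_le_add']
      refine le_inf ?_ ?_
      · rw [sub_le_iff_le_add']; exact inf_le_left
      · exact (sub_le_self _ ha).trans inf_le_right
    · exact (sub_le_self _ (le_inf hb hc)).trans inf_le_right
  exact sub_le_iff_le_add.1 h1

lemma smul_inf_eq_zero {w f : E} (hw : 0 ≤ w) (hf : 0 ≤ f) (h : w ⊓ f = 0) {r : ℝ} (hr : 0 ≤ r) :
    (r • w) ⊓ f = 0 := by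
  apply le_antisymm _ (le_inf (smul_nonneg hr hw) hf)
  have hM : 0 < max r 1 := lt_max_of_lt_right one_pos
  have : (max r 1)⁻¹ • ((r • w) ⊓ f) ≤ w ⊓ f := by
    refine le_inf ?_ ?_
    · rw [inv_smul_le_iff_of_pos hM]
      exact inf_le_left.trans (smul_le_smul_of_nonneg_right (le_max_left _ _) hw)
    · rw [inv_smul_le_iff_of_pos hM]
      refine inf_le_right.trans ?_
      simpa using smul_le_smul_of_nonneg_right (le_max_right r 1) hf
  rw [h, inv_smul_le_iff_of_pos hM] at this
  simpa using this

/-! ### Points -/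

variable (E) in
/-- A point: a decreasing sequence of strictly positive elements. -/
def Pt : Type _ := {F : ℕ → E // Antitone F ∧ ∀ n, 0 < F n}

/-- `x ≤ y` near the point `F`. -/
def Below (F : Pt E) (x y : E) : Prop := ∃ n, (x - y)⁺ ⊓ F.1 n = 0

lemma inf_eq_zero_of_le {a b c d : E} (ha : 0 ≤ a) (hc : 0 ≤ c) (hab : a ≤ b) (hcd : c ≤ d)
    (h : b ⊓ d = 0) : a ⊓ c = 0 :=
  le_antisymm (h ▸ inf_le_inf hab hcd) (le_inf ha hc)

lemma Below.of_inf {F : Pt E} {x y u : E} (h : (x - y)⁺ ⊓ u = 0) {n : ℕ} (hn : F.1 n ≤ u) :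
    Below F x y :=
  ⟨n, inf_eq_zero_of_le (posPart_nonneg _) (F.2.2 n).le le_rfl hn h⟩

lemma Below.of_le (F : Pt E) {x y : E} (h : x ≤ y) : Below F x y :=
  ⟨0, by
    rw [posPart_eq_zero.2 (sub_nonpos.2 h)]
    exact inf_eq_left.2 (F.2.2 0).le⟩

lemma Below.add {F : Pt E} {x y x' y' : E} (h : Below F x y) (h' : Below F x' y') :
    Below F (x + x') (y + y') := by
  obtain ⟨n, hn⟩ := h
  obtain ⟨m, hm⟩ := h'
  refine ⟨max n m, le_antisymm ?_ (le_inf (posPart_nonneg _) (F.2.2 _).le)⟩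
  have h1 : (x + x' - (y + y'))⁺ ≤ (x - y)⁺ + (x' - y')⁺ := by
    refine sup_le ?_ (add_nonneg (posPart_nonneg _) (posPart_nonneg _))
    rw [add_sub_add_comm]
    exact add_le_add (le_posPart _) (le_posPart _)
  refine (inf_le_inf_right _ h1).trans ((add_inf_le (posPart_nonneg _) (posPart_nonneg _)
    (F.2.2 _).le).trans ?_)
  rw [inf_eq_zero_of_le (posPart_nonneg _) (F.2.2 _).le le_rfl (F.2.1 (le_max_left n m)) hn,
    inf_eq_zero_of_le (posPart_nonneg _) (F.2.2 _).le le_rfl (F.2.1 (le_max_right n m)) hm, add_zero]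

lemma Below.trans {F : Pt E} {x y z : E} (h : Below F x y) (h' : Below F y z) : Below F x z := by
  have := (h.add h').add (Below.of_le F (le_refl (-y)))
  convert this using 1 <;> abel

lemma Below.smul {F : Pt E} {x y : E} (h : Below F x y) {r : ℝ} (hr : 0 ≤ r) :
    Below F (r • x) (r • y) := by
  obtain ⟨n, hn⟩ := h
  refine ⟨n, ?_⟩
  have h1 : (r • x - r • y)⁺ ≤ r • (x - y)⁺ := by
    refine sup_le ?_ (smul_nonneg hr (posPart_nonneg _))
    rw [← smul_sub]
    exact smul_le_smul_of_nonneg_left (le_posPart _) hr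
  exact inf_eq_zero_of_le (posPart_nonneg _) (F.2.2 _).le h1 le_rfl
    (smul_inf_eq_zero (posPart_nonneg _) (F.2.2 _).le hn hr)

lemma Below.neg {F : Pt E} {x y : E} (h : Below F x y) : Below F (-y) (-x) := by
  have := h.add (Below.of_le F (le_refl (-x - y)))
  convert this using 1 <;> abel

lemma Below.sup {F : Pt E} {x y z : E} (h : Below F x z) (h' : Below F y z) :
    Below F (x ⊔ y) z := by
  obtain ⟨n, hn⟩ := h
  obtain ⟨m, hm⟩ := h'
  refine ⟨max n m, le_antisymm ?_ (le_inf (posPart_nonneg _) (F.2.2 _).le)⟩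
  have h1 : (x ⊔ y - z)⁺ ≤ (x - z)⁺ + (y - z)⁺ := by
    refine sup_le ?_ (add_nonneg (posPart_nonneg _) (posPart_nonneg _))
    rw [sub_le_iff_le_add]
    refine sup_le ?_ ?_
    · rw [← sub_le_iff_le_add]
      exact (le_posPart _).trans (le_add_of_nonneg_right (posPart_nonneg _))
    · rw [← sub_le_iff_le_add]
      exact (le_posPart _).trans (le_add_of_nonneg_left (posPart_nonneg _))
  refine (inf_le_inf_right _ h1).trans ((add_inf_le (posPart_nonneg _) (posPart_nonneg _)
    (F.2.2 _).le).trans ?_)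
  rw [inf_eq_zero_of_le (posPart_nonneg _) (F.2.2 _).le le_rfl (F.2.1 (le_max_left n m)) hn,
    inf_eq_zero_of_le (posPart_nonneg _) (F.2.2 _).le le_rfl (F.2.1 (le_max_right n m)) hm, add_zero]

/-- Consistency of evaluation: no strictly positive `F n` is disjoint from a weak order unit. This
is what makes values unique. -/
lemma not_below_of_pos {e : E} (he : IsWeakOrderUnit e) (F : Pt E) {r s : ℝ} (h : s < r) :
    ¬ Below F (r • e) (s • e) := by
  rintro ⟨n, hn⟩
  rw [← sub_smul, posPart_of_nonneg (smul_nonneg (sub_nonneg.2 h.le) he.1)] at hn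
  have h2 := smul_inf_eq_zero (smul_nonneg (sub_nonneg.2 h.le) he.1) (F.2.2 n).le hn
    (inv_nonneg.2 (sub_nonneg.2 h.le))
  rw [inv_smul_smul₀ (sub_pos.2 h).ne', inf_comm] at h2
  have := he.2 (F.1 n) (by rwa [abs_of_nonneg (F.2.2 n).le])
  exact (F.2.2 n).ne' this

/-! ### The filter of generic sets of points -/

/-- `D` is dense among the strictly positive elements. -/
def DenseBelow (D : Set E) : Prop := ∀ u, 0 < u → ∃ v ∈ D, 0 < v ∧ v ≤ u

variable (E) in
/-- The filter of generic sets of points. -/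
def generic : Filter (Pt E) :=
  countableGenerate {U | ∃ D : Set E, DenseBelow D ∧ U = {F | ∃ n, F.1 n ∈ D}}

instance : CountableInterFilter (generic E) := by unfold generic; infer_instance

lemma eventually_meets {D : Set E} (hD : DenseBelow D) : ∀ᶠ F in generic E, ∃ n, F.1 n ∈ D :=
  CountableGenerateSets.basic ⟨D, hD, rfl⟩

/-- A Baire-type argument: a generic set depends on countably many dense sets only, so a sequence
that starts at `u` can descend into them one after another. -/
lemma exists_point_le {U : Set (Pt E)} (hU : U ∈ generic E) {u : E} (hu : 0 < u) :
    ∃ F ∈ U, F.1 0 ≤ u := by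
  obtain ⟨S, hS, hSc, hSU⟩ := mem_countableGenerate_iff.1 hU
  have huniv : DenseBelow (univ : Set E) := fun u hu => ⟨u, trivial, hu, le_rfl⟩
  have : ∃ D : ℕ → Set E, (∀ n, DenseBelow (D n)) ∧ ∀ V ∈ S, ∃ n, V = {F | ∃ m, F.1 m ∈ D n} := by
    rcases S.eq_empty_or_nonempty with rfl | hne
    · exact ⟨fun _ => univ, fun _ => huniv, by simp⟩
    · obtain ⟨f, hf⟩ := hSc.exists_eq_range hne
      have h1 : ∀ n, ∃ D : Set E, DenseBelow D ∧ f n = {F | ∃ n, F.1 n ∈ D} :=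
        fun n => hS (hf ▸ mem_range_self n)
      choose D hD hD' using h1
      refine ⟨D, hD, fun V hV => ?_⟩
      rw [hf] at hV
      obtain ⟨n, rfl⟩ := hV
      exact ⟨n, hD' n⟩
  obtain ⟨D, hD, hDS⟩ := this
  choose! next hnD hn0 hnle using fun n => hD n
  let s : ℕ → {v : E // 0 < v} := fun n =>
    Nat.rec ⟨u, hu⟩ (fun n v => ⟨next n v.1, hn0 n v.1 v.2⟩) n
  have hs : ∀ n, (s (n + 1)).1 = next n (s n).1 := fun n => rfl
  refine ⟨⟨fun n => (s n).1, antitone_nat_of_succ_le fun n => ?_, fun n => (s n).2⟩,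
    hSU fun V hV => ?_, le_rfl⟩
  · rw [hs]; exact hnle n _ (s n).2
  · obtain ⟨n, rfl⟩ := hDS V hV
    -- Index `0` holds `u` itself, so `D n` is entered at step `n + 1`.
    exact ⟨n + 1, by simpa only [hs] using hnD n _ (s n).2⟩

/-- The elements `(x - y)⁺` and `(y - x)⁺` are disjoint: either `u` is already disjoint from the
first, or its infimum with the first is a nonzero element disjoint from the second. -/
lemma eventually_below_or (x y : E) : ∀ᶠ F in generic E, Below F x y ∨ Below F y x := by
  have hD : DenseBelow {u : E | (x - y)⁺ ⊓ u = 0 ∨ (y - x)⁺ ⊓ u = 0} := fun u hu => by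
    by_cases h : (x - y)⁺ ⊓ u = 0
    · exact ⟨u, Or.inl h, hu, le_rfl⟩
    · have h0 : 0 ≤ (x - y)⁺ ⊓ u := le_inf (posPart_nonneg _) hu.le
      refine ⟨(x - y)⁺ ⊓ u, Or.inr ?_, lt_of_le_of_ne h0 (Ne.symm h), inf_le_right⟩
      have h1 : (y - x)⁺ ⊓ (x - y)⁺ = 0 := by
        rw [← neg_sub x y, posPart_neg, inf_comm]
        exact posPart_inf_negPart_eq_zero _
      exact inf_eq_zero_of_le (posPart_nonneg _) h0 le_rfl inf_le_left h1
  filter_upwards [eventually_meets hD] with F hF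
  obtain ⟨n, hn | hn⟩ := hF
  · exact Or.inl ⟨n, hn⟩
  · exact Or.inr ⟨n, hn⟩

/-- This makes values finite. If `u` were disjoint from every `((n + 1) e - x)⁺`, then `e ⊓ u ≤ x⁺ /
(n + 1)` for all `n`, hence `e ⊓ u = 0`, against `e` being a weak unit. -/
lemma eventually_exists_below_nat {e : E} (he : IsWeakOrderUnit e) (x : E) :
    ∀ᶠ F in generic E, ∃ n : ℕ, Below F x ((n : ℝ) • e) := by
  have hD : DenseBelow {u : E | ∃ n : ℕ, (x - (n : ℝ) • e)⁺ ⊓ u = 0} := fun u hu => by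
    by_cases h : ∀ n : ℕ, (((n : ℝ) + 1) • e - x)⁺ ⊓ u = 0
    · exfalso
      have h0 : 0 ≤ e ⊓ u := le_inf he.1 hu.le
      have h1 : e ⊓ u ≤ 0 := by
        refine nonpos_of_forall_le_smul (y := x⁺) fun n => ?_
        have hn : (0 : ℝ) < (n : ℝ) + 1 := by positivity
        have h2 := smul_inf_eq_zero (posPart_nonneg _) hu.le (h n) (inv_nonneg.2 hn.le)
        have h3 : e - ((n : ℝ) + 1)⁻¹ • x⁺ ≤ ((n : ℝ) + 1)⁻¹ • (((n : ℝ) + 1) • e - x)⁺ := by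
          have : ((n : ℝ) + 1)⁻¹ • (((n : ℝ) + 1) • e - x⁺)
              ≤ ((n : ℝ) + 1)⁻¹ • (((n : ℝ) + 1) • e - x)⁺ :=
            smul_le_smul_of_nonneg_left ((sub_le_sub_left (le_posPart x) _).trans (le_posPart _))
              (inv_nonneg.2 hn.le)
          rwa [smul_sub, inv_smul_smul₀ hn.ne'] at this
        have h4 : e ⊓ u - ((n : ℝ) + 1)⁻¹ • x⁺ ≤ 0 := by
          rw [← h2]
          refine le_inf ((sub_le_sub_right inf_le_left _).trans h3) ?_
          exact (sub_le_self _ (smul_nonneg (inv_nonneg.2 hn.le) (posPart_nonneg _))).trans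
            inf_le_right
        exact sub_nonpos.1 h4
      have h2 := he.2 u (by rw [abs_of_nonneg hu.le, inf_comm]; exact le_antisymm h1 h0)
      exact hu.ne' h2
    · push Not at h
      obtain ⟨n, hn⟩ := h
      have h0 : 0 ≤ (((n : ℝ) + 1) • e - x)⁺ ⊓ u := le_inf (posPart_nonneg _) hu.le
      refine ⟨(((n : ℝ) + 1) • e - x)⁺ ⊓ u, ⟨n + 1, ?_⟩, lt_of_le_of_ne h0 (Ne.symm hn),
        inf_le_right⟩
      have h1 : (x - ((n : ℝ) + 1) • e)⁺ ⊓ (((n : ℝ) + 1) • e - x)⁺ = 0 := by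
        rw [← neg_sub x, posPart_neg]
        exact posPart_inf_negPart_eq_zero _
      push_cast
      exact inf_eq_zero_of_le (posPart_nonneg _) h0 le_rfl inf_le_left h1
  filter_upwards [eventually_meets hD] with F ⟨n, m, hm⟩
  exact ⟨m, n, hm⟩

/-- A generic point comes arbitrarily close to a supremum. -/
lemma eventually_exists_below_of_isGLB {e : E} (he : IsWeakOrderUnit e) {A : Set E}
    (hA : IsGLB A 0) {ε : ℝ} (hε : 0 < ε) :
    ∀ᶠ F in generic E, ∃ a ∈ A, Below F a (ε • e) := by
  have hD : DenseBelow {u : E | ∃ a ∈ A, (a - ε • e)⁺ ⊓ u = 0} := fun u hu => by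
    by_cases h : ∀ a ∈ A, (ε • e - a)⁺ ⊓ u = 0
    · exfalso
      have h0 : 0 ≤ (ε • e) ⊓ u := le_inf (smul_nonneg hε.le he.1) hu.le
      have h1 : (ε • e) ⊓ u ≤ 0 := by
        refine hA.2 fun a ha => ?_
        have : (ε • e) ⊓ u - a ≤ 0 := by
          rw [← h a ha]
          exact le_inf ((sub_le_sub_right inf_le_left _).trans (le_posPart _))
            ((sub_le_self _ (hA.1 ha)).trans inf_le_right)
        exact sub_nonpos.1 this
      have h2 := smul_inf_eq_zero (smul_nonneg hε.le he.1) hu.le (le_antisymm h1 h0)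
        (inv_nonneg.2 hε.le)
      rw [inv_smul_smul₀ hε.ne'] at h2
      have h2 := he.2 u (by rw [abs_of_nonneg hu.le, inf_comm]; exact h2)
      exact hu.ne' h2
    · push Not at h
      obtain ⟨a, ha, hn⟩ := h
      have h0 : 0 ≤ (ε • e - a)⁺ ⊓ u := le_inf (posPart_nonneg _) hu.le
      refine ⟨(ε • e - a)⁺ ⊓ u, ⟨a, ha, ?_⟩, lt_of_le_of_ne h0 (Ne.symm hn), inf_le_right⟩
      have h1 : (a - ε • e)⁺ ⊓ (ε • e - a)⁺ = 0 := by
        rw [← neg_sub a, posPart_neg]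
        exact posPart_inf_negPart_eq_zero _
      exact inf_eq_zero_of_le (posPart_nonneg _) h0 le_rfl inf_le_left h1
  filter_upwards [eventually_meets hD] with F ⟨n, a, ha, hm⟩
  exact ⟨a, ha, n, hm⟩

/-! ### The value of an element at a point -/

/-- The value of `x` at the point `F`, when the value of `e` is `1`. -/
def val (e : E) (F : Pt E) (x : E) : ℝ := sSup {q : ℝ | Below F (q • e) x}

/-- `r` is the value of `x` at the point `F`. -/
def IsVal (e : E) (F : Pt E) (x : E) (r : ℝ) : Prop :=
  (∀ q < r, Below F (q • e) x) ∧ ∀ q, r < q → Below F x (q • e)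

variable {e : E}

lemma IsVal.mono (he : IsWeakOrderUnit e) {F : Pt E} {x y : E} {r s : ℝ} (hx : IsVal e F x r)
    (hy : IsVal e F y s) (h : Below F x y) : r ≤ s := by
  by_contra! hlt
  obtain ⟨a, ha, ha'⟩ := exists_between hlt
  obtain ⟨b, hb, hb'⟩ := exists_between ha'
  exact not_below_of_pos he F hb (((hx.1 b hb').trans h).trans (hy.2 a ha))

lemma IsVal.val_eq (he : IsWeakOrderUnit e) {F : Pt E} {x : E} {r : ℝ} (hx : IsVal e F x r) :
    val e F x = r := by
  refine csSup_eq_of_forall_le_of_forall_lt_exists_gt ⟨r - 1, hx.1 _ (by linarith)⟩ ?_ ?_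
  · intro q hq
    by_contra! hlt
    obtain ⟨a, ha, ha'⟩ := exists_between hlt
    exact not_below_of_pos he F ha' (Below.trans hq (hx.2 a ha))
  · intro w hw
    obtain ⟨a, ha, ha'⟩ := exists_between hw
    exact ⟨a, hx.1 a ha', ha⟩

lemma isVal_smul_unit (he : IsWeakOrderUnit e) (F : Pt E) (r : ℝ) : IsVal e F (r • e) r :=
  ⟨fun _ hq => .of_le F (smul_le_smul_of_nonneg_right hq.le he.1),
    fun _ hq => .of_le F (smul_le_smul_of_nonneg_right hq.le he.1)⟩

lemma IsVal.add {F : Pt E} {x y : E} {r s : ℝ} (hx : IsVal e F x r) (hy : IsVal e F y s) :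
    IsVal e F (x + y) (r + s) := by
  refine ⟨fun q hq => ?_, fun q hq => ?_⟩
  -- The gap between `q` and `r + s` is shared equally; the two shifted constants add up to `q`.
  · have h := (hx.1 (r - (r + s - q) / 2) (by linarith)).add (hy.1 (s - (r + s - q) / 2)
      (by linarith))
    rw [← add_smul] at h
    convert h using 2
    ring
  · have h := (hx.2 (r - (r + s - q) / 2) (by linarith)).add (hy.2 (s - (r + s - q) / 2)
      (by linarith))
    rw [← add_smul] at h
    convert h using 2
    ring

lemma IsVal.neg {F : Pt E} {x : E} {r : ℝ} (hx : IsVal e F x r) : IsVal e F (-x) (-r) := by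
  refine ⟨fun q hq => ?_, fun q hq => ?_⟩
  · simpa using (hx.2 (-q) (by linarith)).neg
  · simpa using (hx.1 (-q) (by linarith)).neg

lemma IsVal.smul_pos {F : Pt E} {x : E} {r : ℝ} (hx : IsVal e F x r) {a : ℝ} (ha : 0 < a) :
    IsVal e F (a • x) (a * r) := by
  refine ⟨fun q hq => ?_, fun q hq => ?_⟩
  · have := (hx.1 (a⁻¹ * q) (by rwa [inv_mul_lt_iff₀ ha])).smul ha.le
    rwa [smul_smul, mul_inv_cancel_left₀ ha.ne'] at this
  · have := (hx.2 (a⁻¹ * q) (by rwa [lt_inv_mul_iff₀ ha])).smul ha.le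
    rwa [smul_smul, mul_inv_cancel_left₀ ha.ne'] at this

lemma IsVal.smul (he : IsWeakOrderUnit e) {F : Pt E} {x : E} {r : ℝ} (hx : IsVal e F x r) (a : ℝ) :
    IsVal e F (a • x) (a * r) := by
  rcases lt_trichotomy a 0 with h | rfl | h
  · simpa using (hx.smul_pos (neg_pos.2 h)).neg
  · simpa using isVal_smul_unit he F 0
  · exact hx.smul_pos h

lemma IsVal.sup {F : Pt E} {x y : E} {r s : ℝ} (hx : IsVal e F x r) (hy : IsVal e F y s) :
    IsVal e F (x ⊔ y) (r ⊔ s) := by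
  refine ⟨fun q hq => ?_, fun q hq => ?_⟩
  · rcases lt_max_iff.1 hq with h | h
    · exact (hx.1 q h).trans (.of_le F le_sup_left)
    · exact (hy.1 q h).trans (.of_le F le_sup_right)
  · obtain ⟨h1, h2⟩ := max_lt_iff.1 hq
    exact (hx.2 q h1).sup (hy.2 q h2)

/-- Comparing `x` with the rational multiples of `e` costs only countably many generic conditions
and already determines a Dedekind cut. -/
lemma eventually_isVal (he : IsWeakOrderUnit e) (x : E) :
    ∀ᶠ F in generic E, IsVal e F x (val e F x) := by
  have h1 : ∀ᶠ F in generic E, ∀ q : ℚ, Below F x ((q : ℝ) • e) ∨ Below F ((q : ℝ) • e) x :=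
    eventually_countable_forall.2 fun q => eventually_below_or _ _
  filter_upwards [h1, eventually_exists_below_nat he x, eventually_exists_below_nat he (-x)]
    with F hF ⟨n, hn⟩ ⟨m, hm⟩
  have hbdd : BddAbove {q : ℝ | Below F (q • e) x} := ⟨n, fun q hq => by
    by_contra! hlt
    exact not_below_of_pos he F hlt (Below.trans hq hn)⟩
  have hne : {q : ℝ | Below F (q • e) x}.Nonempty := ⟨-m, by simpa using hm.neg⟩
  refine ⟨fun q hq => ?_, fun q hq => ?_⟩
  · obtain ⟨a, ha, hqa⟩ := exists_lt_of_lt_csSup hne hq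
    exact (Below.of_le F (smul_le_smul_of_nonneg_right hqa.le he.1)).trans ha
  · obtain ⟨a, ha, ha'⟩ := exists_rat_btwn hq
    rcases hF a with h | h
    · exact h.trans (.of_le F (smul_le_smul_of_nonneg_right ha'.le he.1))
    · exact absurd (le_csSup hbdd h) (not_le.2 ha)

section val
variable (he : IsWeakOrderUnit e)
include he

lemma val_smul_unit (F : Pt E) (r : ℝ) : val e F (r • e) = r := (isVal_smul_unit he F r).val_eq he

lemma val_unit (F : Pt E) : val e F e = 1 := by simpa using val_smul_unit he F 1

lemma val_zero (F : Pt E) : val e F 0 = 0 := by simpa using val_smul_unit he F 0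

lemma val_add (x y : E) : ∀ᶠ F in generic E, val e F (x + y) = val e F x + val e F y := by
  filter_upwards [eventually_isVal he x, eventually_isVal he y] with F hx hy
  exact (hx.add hy).val_eq he

lemma val_neg (x : E) : ∀ᶠ F in generic E, val e F (-x) = -val e F x := by
  filter_upwards [eventually_isVal he x] with F hx
  exact hx.neg.val_eq he

lemma val_sub (x y : E) : ∀ᶠ F in generic E, val e F (x - y) = val e F x - val e F y := by
  filter_upwards [eventually_isVal he x, eventually_isVal he y] with F hx hy
  rw [sub_eq_add_neg, (hx.add hy.neg).val_eq he, sub_eq_add_neg]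

lemma val_smul (a : ℝ) (x : E) : ∀ᶠ F in generic E, val e F (a • x) = a * val e F x := by
  filter_upwards [eventually_isVal he x] with F hx
  exact (hx.smul he a).val_eq he

lemma val_sup (x y : E) : ∀ᶠ F in generic E, val e F (x ⊔ y) = val e F x ⊔ val e F y := by
  filter_upwards [eventually_isVal he x, eventually_isVal he y] with F hx hy
  exact (hx.sup hy).val_eq he

lemma val_inf (x y : E) : ∀ᶠ F in generic E, val e F (x ⊓ y) = val e F x ⊓ val e F y := by
  filter_upwards [eventually_isVal he x, eventually_isVal he y] with F hx hy
  have h := (hx.neg.sup hy.neg).neg.val_eq he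
  rwa [← neg_inf, neg_neg, ← neg_inf, neg_neg] at h

lemma val_posPart (x : E) : ∀ᶠ F in generic E, val e F x⁺ = val e F x ⊔ 0 := by
  filter_upwards [val_sup he x 0] with F h
  rw [posPart_def, h, val_zero he]

lemma val_negPart (x : E) : ∀ᶠ F in generic E, val e F x⁻ = -val e F x ⊔ 0 := by
  filter_upwards [val_sup he (-x) 0, val_neg he x] with F h h'
  rw [negPart_def, h, val_zero he, h']

lemma val_abs (x : E) : ∀ᶠ F in generic E, val e F |x| = |val e F x| := by
  filter_upwards [val_sup he x (-x), val_neg he x] with F h h'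
  rw [abs, h, h']; rfl

lemma val_sum {ι : Type*} (s : Finset ι) (f : ι → E) :
    ∀ᶠ F in generic E, val e F (∑ i ∈ s, f i) = ∑ i ∈ s, val e F (f i) := by
  classical
  induction s using Finset.induction_on with
  | empty => exact Eventually.of_forall fun F => by simpa using val_zero he F
  | insert a s ha ih =>
    filter_upwards [ih, val_add he (f a) (∑ i ∈ s, f i)] with F h h'
    rw [Finset.sum_insert ha, Finset.sum_insert ha, h', h]

lemma val_mono {x y : E} (h : x ≤ y) : ∀ᶠ F in generic E, val e F x ≤ val e F y := by
  filter_upwards [eventually_isVal he x, eventually_isVal he y] with F hx hy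
  exact hx.mono he hy (.of_le F h)

/-- If `x ≤ y` fails, then by the Archimedean property `(x - y - δ e)⁺ ≠ 0` for some `δ > 0`. At a
generic point starting below this element, `x - y` has value at least `δ`. -/
lemma le_of_val_le {x y : E} (h : ∀ᶠ F in generic E, val e F x ≤ val e F y) : x ≤ y := by
  by_contra hxy
  have : ∃ n : ℕ, (x - y - ((n : ℝ) + 1)⁻¹ • e)⁺ ≠ 0 := by
    by_contra! h0
    refine hxy (sub_nonpos.1 (nonpos_of_forall_le_smul (y := e) fun n => ?_))
    exact sub_nonpos.1 (posPart_eq_zero.1 (h0 n))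
  obtain ⟨n, hn⟩ := this
  have hδ : (0 : ℝ) < ((n : ℝ) + 1)⁻¹ := by positivity
  set δ : ℝ := ((n : ℝ) + 1)⁻¹
  obtain ⟨F, ⟨h1, h2, h3⟩, h4⟩ := exists_point_le
    (h.and ((val_sub he x y).and (eventually_isVal he (x - y))))
    (lt_of_le_of_ne (posPart_nonneg _) (Ne.symm hn))
  have h5 : Below F (δ • e) (x - y) := by
    refine Below.of_inf ?_ h4
    rw [← neg_sub, posPart_neg, inf_comm]
    exact posPart_inf_negPart_eq_zero _
  have := (isVal_smul_unit he F δ).mono he h3 h5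
  linarith

lemma eq_iff_val {x y : E} : x = y ↔ ∀ᶠ F in generic E, val e F x = val e F y :=
  ⟨fun h => Eventually.of_forall fun F => by rw [h], fun h => le_antisymm
    (le_of_val_le he (h.mono fun _ h => h.le)) (le_of_val_le he (h.mono fun _ h => h.ge))⟩

lemma val_nonneg {x : E} (h : 0 ≤ x) : ∀ᶠ F in generic E, 0 ≤ val e F x := by
  filter_upwards [val_mono he h] with F hF
  rwa [val_zero he] at hF

lemma nonneg_of_val {x : E} (h : ∀ᶠ F in generic E, 0 ≤ val e F x) : 0 ≤ x :=
  le_of_val_le he (by simpa only [val_zero he] using h)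

/-- For each tolerance `1 / (n + 1)` a generic point meets a region where some `f i` is that close
to `s`. Countability of `ι` lets all the `f i` be evaluated at one generic point. -/
lemma val_isLUB {ι : Type*} [Countable ι] {f : ι → E} {s : E} (h : IsLUB (range f) s) :
    ∀ᶠ F in generic E, IsLUB (range fun i => val e F (f i)) (val e F s) := by
  have h0 : IsGLB (range fun i => s - f i) 0 := by
    refine ⟨?_, fun b hb => ?_⟩
    · rintro _ ⟨i, rfl⟩
      exact sub_nonneg.2 (h.1 (mem_range_self i))
    · have : s ≤ s - b := h.2 (by
        rintro _ ⟨i, rfl⟩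
        have := hb (mem_range_self i)
        exact le_sub_comm.1 this)
      simpa using this
  have h1 : ∀ᶠ F in generic E, ∀ n : ℕ, ∃ i, Below F (s - f i) (((n : ℝ) + 1)⁻¹ • e) := by
    refine eventually_countable_forall.2 fun n => ?_
    filter_upwards [eventually_exists_below_of_isGLB he h0
      (show (0 : ℝ) < ((n : ℝ) + 1)⁻¹ by positivity)] with F hF
    simpa using hF
  have h2 : ∀ᶠ F in generic E, ∀ i, IsVal e F (f i) (val e F (f i)) :=
    eventually_countable_forall.2 fun i => eventually_isVal he _
  filter_upwards [h1, h2, eventually_isVal he s] with F h1 h2 h3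
  refine ⟨?_, fun b hb => ?_⟩
  · rintro _ ⟨i, rfl⟩
    exact (h2 i).mono he h3 (.of_le F (h.1 (mem_range_self i)))
  · refine le_of_forall_pos_le_add fun ε hε => ?_
    obtain ⟨n, hn⟩ := exists_nat_one_div_lt hε
    obtain ⟨i, hi⟩ := h1 n
    have h4 := (h3.add (h2 i).neg).mono he (isVal_smul_unit he F _) (by rwa [← sub_eq_add_neg])
    have h5 := hb (mem_range_self i)
    rw [one_div] at hn
    linarith

lemma isLUB_of_val {ι : Type*} [Countable ι] {f : ι → E} {s : E}
    (h : ∀ᶠ F in generic E, IsLUB (range fun i => val e F (f i)) (val e F s)) :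
    IsLUB (range f) s := by
  refine ⟨?_, fun b hb => le_of_val_le he ?_⟩
  · rintro _ ⟨i, rfl⟩
    exact le_of_val_le he (h.mono fun F hF => hF.1 (mem_range_self i))
  · have : ∀ᶠ F in generic E, ∀ i, val e F (f i) ≤ val e F b :=
      eventually_countable_forall.2 fun i => val_mono he (hb (mem_range_self i))
    filter_upwards [h, this] with F h1 h2
    exact h1.2 (by rintro _ ⟨i, rfl⟩; exact h2 i)

end val

/-! ### Band projections at a point -/

lemma isLUB_inf_mul_abs {a : ℝ} (ha : 0 ≤ a) (b : ℝ) :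
    IsLUB (range fun n : ℕ => a ⊓ n * |b|) (if b = 0 then 0 else a) := by
  split_ifs with h
  · simp [h, ha]
  · refine ⟨?_, fun c hc => ?_⟩
    · rintro _ ⟨n, rfl⟩; exact inf_le_left
    · obtain ⟨n, hn⟩ := exists_nat_ge (a / |b|)
      rw [div_le_iff₀ (abs_pos.2 h)] at hn
      have : a ⊓ n * |b| ≤ c := hc (mem_range_self n)
      rwa [inf_eq_left.2 hn] at this

section val
variable (he : IsWeakOrderUnit e)
include he

lemma val_iSup_inf_smul {y : E} (hy : 0 ≤ y) (u : E) :
    ∀ᶠ F in generic E, val e F (⨆ n : ℕ, y ⊓ (n : ℝ) • |u|) =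
      if val e F u = 0 then 0 else val e F y := by
  have hb : BddAbove (range fun n : ℕ => y ⊓ (n : ℝ) • |u|) :=
    ⟨y, by rintro _ ⟨n, rfl⟩; exact inf_le_left⟩
  have h1 : ∀ᶠ F in generic E, ∀ n : ℕ,
      val e F (y ⊓ (n : ℝ) • |u|) = val e F y ⊓ n * |val e F u| := by
    refine eventually_countable_forall.2 fun n => ?_
    filter_upwards [val_inf he y ((n : ℝ) • |u|), val_smul he (n : ℝ) |u|, val_abs he u]
      with F h1 h2 h3
    rw [h1, h2, h3]
  filter_upwards [val_isLUB he (isLUB_ciSup hb), h1, val_nonneg he hy] with F h2 h1 h3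
  simp only [h1] at h2
  exact h2.unique (isLUB_inf_mul_abs h3 _)

lemma val_bandProj (u y : E) :
    ∀ᶠ F in generic E, val e F (bandProj u y) = if val e F u = 0 then 0 else val e F y := by
  filter_upwards [val_iSup_inf_smul he (posPart_nonneg y) u, val_posPart he y, val_negPart he y,
    val_iSup_inf_smul he (negPart_nonneg y) u,
    val_sub he (⨆ n : ℕ, y⁺ ⊓ (n : ℝ) • |u|) (⨆ n : ℕ, y⁻ ⊓ (n : ℝ) • |u|)] with F h1 h2 h3 h4 h5
  rw [bandProj, h5, h1, h4, h2, h3]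
  split_ifs
  · simp
  · rcases le_total (val e F y) 0 with h | h <;> simp [h]

/-- The band projection onto the band generated by `u`, as a linear map. -/
def bandProjₗ (u : E) : E →ₗ[ℝ] E where
  toFun := bandProj u
  map_add' x y := (eq_iff_val he).2 <| by
    filter_upwards [val_bandProj he u x, val_bandProj he u y, val_bandProj he u (x + y),
      val_add he x y, val_add he (bandProj u x) (bandProj u y)] with F h1 h2 h3 h4 h5
    rw [h3, h5, h1, h2, h4]
    split_ifs <;> simp
  map_smul' r x := (eq_iff_val he).2 <| by
    filter_upwards [val_bandProj he u x, val_bandProj he u (r • x), val_smul he r x,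
      val_smul he r (bandProj u x)] with F h1 h2 h3 h4
    simp only [RingHom.id_apply]
    rw [h2, h4, h1, h3]
    split_ifs <;> simp

lemma bandProjₗ_apply (u y : E) : bandProjₗ he u y = bandProj u y := rfl

/-- The band projection `P_{x = te}`, as a linear map. -/
def projEqₗ (x : E) (t : ℝ) : E →ₗ[ℝ] E := LinearMap.id - bandProjₗ he |x - t • e|

lemma projEqₗ_apply (x : E) (t : ℝ) (y : E) : projEqₗ he x t y = projEq x (t • e) y := rfl

lemma val_projEq (x : E) (t : ℝ) (y : E) :
    ∀ᶠ F in generic E, val e F (projEq x (t • e) y) = if val e F x = t then val e F y else 0 := by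
  filter_upwards [val_bandProj he |x - t • e| y, val_abs he (x - t • e), val_sub he x (t • e),
    val_sub he y (bandProj |x - t • e| y)] with F h1 h2 h3 h4
  rw [projEq, h4, h1, h2, h3, val_smul_unit he]
  simp only [abs_eq_zero, sub_eq_zero]
  split_ifs <;> simp

omit he in
/-- An operator that multiplies by an indicator at generic points. -/
def IsIndicatorOp (e : E) (P : E →ₗ[ℝ] E) : Prop :=
  ∀ x, ∀ᶠ F in generic E, (val e F (P e) = 0 ∨ val e F (P e) = 1) ∧
    val e F (P x) = val e F (P e) * val e F x

lemma IsIndicatorOp.isBandProjection {P : E →ₗ[ℝ] E} (hP : IsIndicatorOp e P) :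
    IsBandProjection P where
  idem x := (eq_iff_val he).2 <| by
    filter_upwards [hP x, hP (P x)] with F ⟨h1, h2⟩ ⟨_, h4⟩
    rw [h4, h2]
    rcases h1 with h | h <;> simp [h]
  nonneg x hx := nonneg_of_val he <| by
    filter_upwards [hP x, val_nonneg he hx] with F ⟨h1, h2⟩ h3
    rw [h2]
    rcases h1 with h | h <;> simp [h, h3]
  le_self x hx := le_of_val_le he <| by
    filter_upwards [hP x, val_nonneg he hx] with F ⟨h1, h2⟩ h3
    rw [h2]
    rcases h1 with h | h <;> simp [h, h3]

lemma isIndicatorOp_projEqₗ (u : E) (t : ℝ) : IsIndicatorOp e (projEqₗ he u t) := fun x => by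
  filter_upwards [val_projEq he u t x, val_projEq he u t e] with F h1 h2
  rw [projEqₗ_apply, projEqₗ_apply, h1, h2, val_unit he]
  split_ifs <;> simp

/-- The component of `e` on which `t e < x`. -/
lemma val_bandProj_posPart (x : E) (t : ℝ) :
    ∀ᶠ F in generic E, val e F (bandProj (x - t • e)⁺ e) = if t < val e F x then 1 else 0 := by
  filter_upwards [val_bandProj he (x - t • e)⁺ e, val_posPart he (x - t • e),
    val_sub he x (t • e)] with F h1 h2 h3
  rw [h1, h2, h3, val_smul_unit he, val_unit he]
  by_cases h : t < val e F x
  · rw [if_pos h, if_neg]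
    rw [sup_eq_left.2 (by linarith)]
    linarith
  · rw [if_neg h, if_pos]
    rw [sup_eq_right.2 (by linarith)]

lemma val_spectral_sub (x : E) {a b : ℝ} (hab : a < b) :
    ∀ᶠ F in generic E, val e F (spectral e x b - spectral e x a) =
      if a < val e F x ∧ val e F x ≤ b then 1 else 0 := by
  filter_upwards [val_bandProj_posPart he x a, val_bandProj_posPart he x b,
    val_sub he e (bandProj (x - a • e)⁺ e), val_sub he e (bandProj (x - b • e)⁺ e),
    val_sub he (spectral e x b) (spectral e x a)] with F h1 h2 h3 h4 h5
  rw [h5, spectral, spectral, h3, h4, h1, h2, val_unit he]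
  by_cases ha : a < val e F x
  · by_cases hb : b < val e F x
    · simp [ha, hb]
    · simp [ha, hb, not_lt.1 hb]
  · have hb : ¬ b < val e F x := fun h => ha (hab.trans h)
    simp [ha, hb]

lemma isComponent_iff_val {c : E} :
    IsComponent e c ↔ ∀ᶠ F in generic E, val e F c = 0 ∨ val e F c = 1 := by
  have key : ∀ r : ℝ, min r (1 - r) = 0 ↔ r = 0 ∨ r = 1 := fun r => by
    constructor
    · intro h
      rcases min_choice r (1 - r) with h' | h'
      · exact Or.inl (by linarith)
      · exact Or.inr (by linarith)
    · rintro (rfl | rfl) <;> simp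
  have h0 : ∀ᶠ F in generic E, val e F (c ⊓ (e - c)) = min (val e F c) (1 - val e F c) := by
    filter_upwards [val_inf he c (e - c), val_sub he e c] with F h1 h2
    rw [h1, h2, val_unit he]
  rw [IsComponent, eq_iff_val he]
  refine eventually_congr (h0.mono fun F hF => ?_)
  rw [hF, val_zero he, key]

/-! ### Elements with prescribed values -/

/-- The bound `b` is what lets Dedekind completeness supply the supremum inside `E`. -/
lemma exists_val_eq {ι : Type*} [Countable ι] [Nonempty ι] {y : ι → E} {Φ : Pt E → ℝ}
    (hy : ∀ᶠ F in generic E, IsLUB (range fun i => val e F (y i)) (Φ F)) {b : E}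
    (hb : ∀ᶠ F in generic E, Φ F ≤ val e F b) : ∃ w, ∀ᶠ F in generic E, val e F w = Φ F := by
  have hbdd : BddAbove (range y) := ⟨b, by
    rintro _ ⟨i, rfl⟩
    refine le_of_val_le he ?_
    filter_upwards [hy, hb] with F h1 h2
    exact (h1.1 (mem_range_self i)).trans h2⟩
  refine ⟨⨆ i, y i, ?_⟩
  filter_upwards [hy, val_isLUB he (isLUB_ciSup hbdd)] with F h1 h2
  exact h2.unique h1

/-- The set `A` may be uncountable, but the countable family `y` inside it already reaches `Φ`
pointwise. In the forward direction `w` itself serves as the bound that makes an element with values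
`Φ` exist. -/
lemma isLUB_iff_val {ι : Type*} [Countable ι] [Nonempty ι] {A : Set E} {y : ι → E}
    {Φ : Pt E → ℝ} (hyA : ∀ i, y i ∈ A)
    (hA : ∀ a ∈ A, ∀ᶠ F in generic E, val e F a ≤ Φ F)
    (hy : ∀ᶠ F in generic E, IsLUB (range fun i => val e F (y i)) (Φ F)) {w : E} :
    IsLUB A w ↔ ∀ᶠ F in generic E, val e F w = Φ F := by
  have hle : ∀ b ∈ upperBounds A, ∀ᶠ F in generic E, Φ F ≤ val e F b := fun b hb => by
    have : ∀ᶠ F in generic E, ∀ i, val e F (y i) ≤ val e F b :=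
      eventually_countable_forall.2 fun i => val_mono he (hb (hyA i))
    filter_upwards [hy, this] with F h1 h2
    exact h1.2 (by rintro _ ⟨i, rfl⟩; exact h2 i)
  have key : ∀ w, (∀ᶠ F in generic E, val e F w = Φ F) → IsLUB A w := fun w hw => by
    refine ⟨fun a ha => le_of_val_le he ?_, fun b hb => le_of_val_le he ?_⟩
    · filter_upwards [hw, hA a ha] with F h1 h2
      rwa [h1]
    · filter_upwards [hw, hle b hb] with F h1 h2
      rwa [h1]
  refine ⟨fun h => ?_, key w⟩
  obtain ⟨w', hw'⟩ := exists_val_eq he hy (hle w h.1)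
  rwa [h.unique (key w' hw')]

end val

/-! ### Products -/

lemma isLUB_prod_lt {ι : Type*} [Fintype ι] {u : ι → ℝ} (hu : ∀ i, 0 ≤ u i) :
    IsLUB (range fun q : ι → ℚ≥0 => (∏ i, (q i : ℝ)) * if ∀ i, (q i : ℝ) < u i then 1 else 0)
      (∏ i, u i) := by
  classical
  refine ⟨?_, fun b hb => ?_⟩
  · rintro _ ⟨q, rfl⟩
    by_cases h : ∀ i, (q i : ℝ) < u i
    · simp only [if_pos h, mul_one]
      exact Finset.prod_le_prod (fun i _ => by positivity) fun i _ => (h i).le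
    · simp only [if_neg h, mul_zero]
      exact Finset.prod_nonneg fun i _ => hu i
  · by_cases h0 : ∃ i, u i = 0
    · obtain ⟨i, hi⟩ := h0
      rw [Finset.prod_eq_zero (Finset.mem_univ i) hi]
      have := hb (mem_range_self 0)
      rwa [if_neg, mul_zero] at this
      push Not
      exact ⟨i, by simp [hi]⟩
    · push Not at h0
      have hpos : ∀ i, 0 < u i := fun i => lt_of_le_of_ne (hu i) (Ne.symm (h0 i))
      -- With all factors positive, there is room for a rational strictly between `δ * u i` and `u
      -- i` whenever `0 < δ < 1`; then `δ` tends to `1`.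
      have ht : Tendsto (fun δ : ℝ => ∏ i, δ * u i) (nhdsWithin 1 (Iio 1)) (nhds (∏ i, u i)) := by
        have : Continuous fun δ : ℝ => ∏ i, δ * u i := by fun_prop
        simpa using (this.tendsto 1).mono_left nhdsWithin_le_nhds
      refine le_of_tendsto ht ?_
      filter_upwards [Ioo_mem_nhdsLT (show (0 : ℝ) < 1 by norm_num)] with δ hδ
      have : ∀ i, ∃ q : ℚ≥0, δ * u i < q ∧ (q : ℝ) < u i := fun i => by
        obtain ⟨q, hq, hq'⟩ := exists_rat_btwn
          (show δ * u i < u i by nlinarith [hpos i, hδ.2])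
        have hq0 : (0 : ℝ) ≤ q := (mul_nonneg hδ.1.le (hu i)).trans hq.le
        exact ⟨⟨q, by exact_mod_cast hq0⟩, by exact_mod_cast hq, by exact_mod_cast hq'⟩
      choose q hq hq' using this
      have h1 := hb (mem_range_self q)
      rw [if_pos hq', mul_one] at h1
      exact (Finset.prod_le_prod (fun i _ => mul_nonneg hδ.1.le (hu i)) fun i _ => (hq i).le).trans
        h1

section val
variable (he : IsWeakOrderUnit e)
include he

lemma exists_val_eq_indicator {ι : Type*} (s : Finset ι) (u : ι → E) (q : ι → ℝ) :
    ∃ c, ∀ᶠ F in generic E, val e F c = if ∀ i ∈ s, q i < val e F (u i) then 1 else 0 := by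
  classical
  induction s using Finset.induction_on with
  | empty => exact ⟨e, Eventually.of_forall fun F => by simp [val_unit he]⟩
  | insert a s ha ih =>
    obtain ⟨c, hc⟩ := ih
    refine ⟨c ⊓ bandProj (u a - q a • e)⁺ e, ?_⟩
    filter_upwards [hc, val_bandProj_posPart he (u a) (q a), val_inf he c _] with F h1 h2 h3
    rw [h3, h1, h2]
    simp only [Finset.forall_mem_insert]
    by_cases hA : q a < val e F (u a) <;> by_cases hB : ∀ i ∈ s, q i < val e F (u i)
    · rw [if_pos hA, if_pos hB, if_pos ⟨hA, hB⟩, min_self]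
    · rw [if_pos hA, if_neg hB, if_neg fun h => hB h.2, min_eq_left zero_le_one]
    · rw [if_neg hA, if_pos hB, if_neg fun h => hA h.1, min_eq_right zero_le_one]
    · rw [if_neg hA, if_neg hB, if_neg fun h => hA h.1, min_self]

/-- Rational coefficients suffice: for each tuple `q`, take the component of `e` on which every `u
i` exceeds `q i`. -/
lemma exists_isPosProd_family {ι : Type*} [Fintype ι] {u : ι → E} (hu : ∀ i, 0 ≤ u i) :
    ∃ y : (ι → ℚ≥0) → E, (∀ q, ∃ (c : E) (a : ι → ℝ), IsComponent e c ∧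
      (∀ i, 0 ≤ a i ∧ a i • c ≤ u i) ∧ y q = (∏ i, a i) • c) ∧
      ∀ᶠ F in generic E, IsLUB (range fun q => val e F (y q)) (∏ i, val e F (u i)) := by
  choose c hc using fun q : ι → ℚ≥0 => exists_val_eq_indicator he Finset.univ u fun i => (q i : ℝ)
  have hu' : ∀ᶠ F in generic E, ∀ i, 0 ≤ val e F (u i) :=
    eventually_countable_forall.2 fun i => val_nonneg he (hu i)
  refine ⟨fun q => (∏ i, (q i : ℝ)) • c q, fun q => ⟨c q, fun i => q i, ?_, fun i => ⟨by positivity,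
    le_of_val_le he ?_⟩, rfl⟩, ?_⟩
  · refine (isComponent_iff_val he).2 ((hc q).mono fun F hF => ?_)
    rw [hF]
    split_ifs <;> simp
  · filter_upwards [hc q, val_smul he (q i : ℝ) (c q), hu'] with F h1 h2 h3
    rw [h2, h1]
    split_ifs with h
    · simpa using (h i (Finset.mem_univ i)).le
    · simpa using h3 i
  · have h1 : ∀ᶠ F in generic E, ∀ q : ι → ℚ≥0, val e F ((∏ i, (q i : ℝ)) • c q) =
        (∏ i, (q i : ℝ)) * if ∀ i, (q i : ℝ) < val e F (u i) then 1 else 0 := by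
      refine eventually_countable_forall.2 fun q => ?_
      filter_upwards [hc q, val_smul he (∏ i, (q i : ℝ)) (c q)] with F h1 h2
      rw [h2, h1]
      simp
    filter_upwards [h1, hu'] with F h1 h2
    simp only [h1]
    exact isLUB_prod_lt h2

lemma isPosProd_iff_val {ι : Type*} [Fintype ι] {u : ι → E} (hu : ∀ i, 0 ≤ u i) {w : E} :
    IsPosProd e u w ↔ ∀ᶠ F in generic E, val e F w = ∏ i, val e F (u i) := by
  obtain ⟨y, hyA, hy⟩ := exists_isPosProd_family he hu
  rw [IsPosProd, and_iff_right hu]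
  refine isLUB_iff_val he (y := y) hyA ?_ hy
  rintro _ ⟨c, a, hc, ha, rfl⟩
  have h1 : ∀ᶠ F in generic E, ∀ i, a i * val e F c ≤ val e F (u i) := by
    refine eventually_countable_forall.2 fun i => ?_
    filter_upwards [val_mono he (ha i).2, val_smul he (a i) c] with F h1 h2
    rwa [← h2]
  have hu' : ∀ᶠ F in generic E, ∀ i, 0 ≤ val e F (u i) :=
    eventually_countable_forall.2 fun i => val_nonneg he (hu i)
  filter_upwards [h1, (isComponent_iff_val he).1 hc, val_smul he (∏ i, a i) c, hu']
    with F h1 h2 h3 h4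
  rw [h3]
  rcases h2 with h | h
  · rw [h, mul_zero]
    exact Finset.prod_nonneg fun i _ => h4 i
  · rw [h, mul_one]
    refine Finset.prod_le_prod (fun i _ => (ha i).1) fun i _ => ?_
    simpa [h] using h1 i

lemma exists_isPosProd {ι : Type*} [Fintype ι] {u : ι → E} (hu : ∀ i, 0 ≤ u i) {b : E}
    (hb : ∀ᶠ F in generic E, ∏ i, val e F (u i) ≤ val e F b) : ∃ w, IsPosProd e u w := by
  obtain ⟨y, hyA, hy⟩ := exists_isPosProd_family he hu
  obtain ⟨w, hw⟩ := exists_val_eq he hy hb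
  exact ⟨w, (isPosProd_iff_val he hu).2 hw⟩

end val

/-! ### Functional calculus -/

lemma isLUB_mul_indicator_Ioc {f : ℝ → ℝ} (hf : Continuous f) (hf0 : ∀ t, 0 ≤ f t) (x : ℝ) :
    IsLUB (range fun q : {q : ℚ × ℚ × ℚ // q.1 < q.2.1 ∧ 0 ≤ q.2.2 ∧
      ∀ t : ℝ, q.1 < t → t ≤ q.2.1 → (q.2.2 : ℝ) ≤ f t} =>
        (q.1.2.2 : ℝ) * if (q.1.1 : ℝ) < x ∧ x ≤ q.1.2.1 then 1 else 0) (f x) := by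
  refine ⟨?_, fun b hb => le_of_forall_lt fun w hw => ?_⟩
  · rintro _ ⟨⟨⟨a, b, α⟩, h1, h2, h3⟩, rfl⟩
    dsimp only
    split_ifs with h
    · simpa using h3 x h.1 h.2
    · simpa using hf0 x
  · obtain ⟨α, hα, hα'⟩ := exists_rat_btwn (show max w (f x / 2 - 1) < f x from
      max_lt hw (by linarith [hf0 x]))
    have hwα := (le_max_left _ _).trans_lt hα
    rcases lt_or_ge α 0 with h0 | h0
    -- A negative `α` is not an admissible height, but the piece of height `0` gives `0 ≤ b`, which
    -- exceeds `w`.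
    · have := hb (mem_range_self ⟨(0, 1, 0), by norm_num, le_rfl, fun t _ _ => by
        simpa using hf0 t⟩)
      simp only [Rat.cast_zero, zero_mul] at this
      have h0' : (α : ℝ) < 0 := by exact_mod_cast h0
      linarith
    · have h1 : ∀ᶠ t in nhds x, (α : ℝ) < f t := hf.continuousAt.eventually (lt_mem_nhds hα')
      obtain ⟨δ, hδ, hball⟩ := Metric.eventually_nhds_iff.1 h1
      obtain ⟨a, ha, ha'⟩ := exists_rat_btwn (show x - δ < x by linarith)
      obtain ⟨c, hc, hc'⟩ := exists_rat_btwn (show x < x + δ by linarith)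
      have hac : (a : ℝ) < c := by linarith
      have := hb (mem_range_self ⟨(a, c, α), by exact_mod_cast hac, h0, fun t ht ht' =>
        (hball (by rw [Real.dist_eq, abs_lt]; constructor <;> linarith)).le⟩)
      simp only [ha', hc.le, and_self, if_true, mul_one] at this
      linarith

section val
variable (he : IsWeakOrderUnit e)
include he

lemma val_smul_spectral_sub (x : E) {f : ℝ → ℝ} : ∀ᶠ F in generic E,
    ∀ q : {q : ℚ × ℚ × ℚ // q.1 < q.2.1 ∧ 0 ≤ q.2.2 ∧
      ∀ t : ℝ, q.1 < t → t ≤ q.2.1 → (q.2.2 : ℝ) ≤ f t},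
    val e F ((q.1.2.2 : ℝ) • (spectral e x q.1.2.1 - spectral e x q.1.1)) =
      (q.1.2.2 : ℝ) * if (q.1.1 : ℝ) < val e F x ∧ val e F x ≤ q.1.2.1 then 1 else 0 := by
  refine eventually_countable_forall.2 fun q => ?_
  have hq : (q.1.1 : ℝ) < q.1.2.1 := by exact_mod_cast q.2.1
  filter_upwards [val_spectral_sub he x hq, val_smul he (q.1.2.2 : ℝ) _] with F h1 h2
  rw [h2, h1]

lemma isFunCalc_iff_val {f : ℝ → ℝ} (hf : Continuous f) (hf0 : ∀ t, 0 ≤ f t) {x w : E} :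
    IsFunCalc e x f w ↔ ∀ᶠ F in generic E, val e F w = f (val e F x) := by
  have : Nonempty {q : ℚ × ℚ × ℚ // q.1 < q.2.1 ∧ 0 ≤ q.2.2 ∧
      ∀ t : ℝ, q.1 < t → t ≤ q.2.1 → (q.2.2 : ℝ) ≤ f t} :=
    ⟨⟨(0, 1, 0), by norm_num, le_rfl, fun t _ _ => by simpa using hf0 t⟩⟩
  refine isLUB_iff_val he (y := fun q : {q : ℚ × ℚ × ℚ // q.1 < q.2.1 ∧ 0 ≤ q.2.2 ∧
      ∀ t : ℝ, q.1 < t → t ≤ q.2.1 → (q.2.2 : ℝ) ≤ f t} =>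
    (q.1.2.2 : ℝ) • (spectral e x q.1.2.1 - spectral e x q.1.1)) ?_ ?_ ?_
  · rintro ⟨⟨a, b, α⟩, h1, h2, h3⟩
    exact ⟨a, b, α, by exact_mod_cast h1, by exact_mod_cast h2, h3, rfl⟩
  · rintro _ ⟨a, b, α, hab, hα, h, rfl⟩
    filter_upwards [val_spectral_sub he x hab, val_smul he α _] with F h1 h2
    rw [h2, h1]
    split_ifs with h'
    · simpa using h _ h'.1 h'.2
    · simpa using hf0 _
  · filter_upwards [val_smul_spectral_sub he x (f := f)] with F h1
    simp only [h1]
    exact isLUB_mul_indicator_Ioc hf hf0 _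

lemma exists_isFunCalc {f : ℝ → ℝ} (hf : Continuous f) (hf0 : ∀ t, 0 ≤ f t) {x b : E}
    (hb : ∀ᶠ F in generic E, f (val e F x) ≤ val e F b) : ∃ w, IsFunCalc e x f w := by
  have : Nonempty {q : ℚ × ℚ × ℚ // q.1 < q.2.1 ∧ 0 ≤ q.2.2 ∧
      ∀ t : ℝ, q.1 < t → t ≤ q.2.1 → (q.2.2 : ℝ) ≤ f t} :=
    ⟨⟨(0, 1, 0), by norm_num, le_rfl, fun t _ _ => by simpa using hf0 t⟩⟩
  obtain ⟨w, hw⟩ := exists_val_eq he (y := fun q : {q : ℚ × ℚ × ℚ // q.1 < q.2.1 ∧ 0 ≤ q.2.2 ∧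
      ∀ t : ℝ, q.1 < t → t ≤ q.2.1 → (q.2.2 : ℝ) ≤ f t} =>
    (q.1.2.2 : ℝ) • (spectral e x q.1.2.1 - spectral e x q.1.1)) (Φ := fun F => f (val e F x))
    (by
      filter_upwards [val_smul_spectral_sub he x (f := f)] with F h1
      simp only [h1]
      exact isLUB_mul_indicator_Ioc hf hf0 _) hb
  exact ⟨w, (isFunCalc_iff_val he hf hf0).2 hw⟩

end val

/-! ### Band projections and subspaces -/

lemma bandProj_of_nonneg {y : E} (hy : 0 ≤ y) (u : E) :
    bandProj u y = ⨆ n : ℕ, y ⊓ (n : ℝ) • |u| := by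
  have h : ∀ n : ℕ, (0 : E) ⊓ (n : ℝ) • |u| = 0 := fun n =>
    inf_eq_left.2 (smul_nonneg n.cast_nonneg (abs_nonneg u))
  simp [bandProj, posPart_of_nonneg hy, negPart_eq_zero.2 hy, h]

lemma monotone_inf_smul_abs (y u : E) : Monotone fun n : ℕ => y ⊓ (n : ℝ) • |u| := fun _ _ h =>
  inf_le_inf_left _ (smul_le_smul_of_nonneg_right (by exact_mod_cast h) (abs_nonneg u))

lemma isLUB_bandProj {y : E} (hy : 0 ≤ y) (u : E) :
    IsLUB (range fun n : ℕ => y ⊓ (n : ℝ) • |u|) (bandProj u y) := by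
  rw [bandProj_of_nonneg hy]
  exact isLUB_ciSup ⟨y, by rintro _ ⟨n, rfl⟩; exact inf_le_left⟩

/-- A subspace that is a sublattice and is closed under suprema of increasing sequences. -/
structure IsSigmaClosed (S : Submodule ℝ E) : Prop where
  sup_mem : ∀ x ∈ S, ∀ y ∈ S, x ⊔ y ∈ S
  lub_mem : ∀ f : ℕ → E, Monotone f → (∀ n, f n ∈ S) → ∀ s, IsLUB (range f) s → s ∈ S

lemma IsClosedRieszSubspace.isSigmaClosed {S : Submodule ℝ E} (hS : IsClosedRieszSubspace S) :
    IsSigmaClosed S :=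
  ⟨hS.1, fun f _ hf s hs =>
    hS.2 (range f) (by rintro _ ⟨n, rfl⟩; exact hf n) (range_nonempty f) s hs⟩

lemma IsSigmaClosed.bandProj_mem {S : Submodule ℝ E} (hS : IsSigmaClosed S) {u y : E}
    (hy : 0 ≤ y) (hyS : y ∈ S) (hu : u ∈ S) : bandProj u y ∈ S := by
  refine hS.lub_mem _ (monotone_inf_smul_abs y u) (fun n => ?_) _ (isLUB_bandProj hy u)
  have h := S.neg_mem (hS.sup_mem _ (S.neg_mem hyS) _
    (S.neg_mem (S.smul_mem (n : ℝ) (hS.sup_mem _ hu _ (S.neg_mem hu)))))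
  rwa [← neg_inf, neg_neg] at h

lemma IsSigmaClosed.spectral_mem {S : Submodule ℝ E} (hS : IsSigmaClosed S) {x : E}
    (he0 : 0 ≤ e) (heS : e ∈ S) (hx : x ∈ S) (t : ℝ) : spectral e x t ∈ S :=
  S.sub_mem heS (hS.bandProj_mem he0 heS
    (hS.sup_mem _ (S.sub_mem hx (S.smul_mem t heS)) _ S.zero_mem))

lemma val_prod_map_apply (he : IsWeakOrderUnit e) {ι : Type*} {P : ι → Module.End ℝ E}
    (hP : ∀ i, IsIndicatorOp e (P i))
    (l : List ι) : ∀ᶠ F in generic E,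
      val e F ((l.map P).prod e) = (l.map fun i => val e F (P i e)).prod := by
  induction l with
  | nil => exact Eventually.of_forall fun F => by simp [val_unit he]
  | cons i l ih =>
    filter_upwards [ih, hP i ((l.map P).prod e)] with F h1 ⟨_, h2⟩
    rw [List.map_cons, List.prod_cons, List.map_cons, List.prod_cons, Module.End.mul_apply, h2, h1]

/-! ### Conditional expectations -/

lemma eq_mul_of_forall_rat {s t y : ℝ} (ht : 0 ≤ t)
    (h : ∀ a b : ℚ, (a : ℝ) < y → y ≤ b → a * t ≤ s ∧ s ≤ b * t) : s = t * y := by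
  refine le_antisymm (le_of_forall_pos_le_add fun ε hε => ?_)
    (le_of_forall_pos_le_add fun ε hε => ?_)
  all_goals
    -- Dividing by `t + 1` rather than `t` covers the case `t = 0`.
    have hη : 0 < ε / (t + 1) := by positivity
    have hη' : ε / (t + 1) * t ≤ ε := by
      rw [div_mul_eq_mul_div, div_le_iff₀ (by positivity)]
      nlinarith
    obtain ⟨a, ha, ha'⟩ := exists_rat_btwn (show y - ε / (t + 1) < y by linarith)
    obtain ⟨b, hb, hb'⟩ := exists_rat_btwn (show y < y + ε / (t + 1) by linarith)
    obtain ⟨h1, h2⟩ := h a b ha' hb.le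
    nlinarith

section condExp

variable {T : E →ₗ[ℝ] E} (hT : IsCondExp e T)
include hT

lemma IsCondExp.mono {x y : E} (h : x ≤ y) : T x ≤ T y := by
  have := hT.nonneg (y - x) (sub_nonneg.2 h)
  rwa [map_sub, sub_nonneg] at this

lemma IsCondExp.eq_zero_of_map {x : E} (hx : 0 ≤ x) (h : T x = 0) : x = 0 := by
  by_contra h0
  exact (hT.strictlyPos x (lt_of_le_of_ne hx (Ne.symm h0))).ne' h

lemma IsCondExp.map_eq_of_mem {y : E} (hy : y ∈ LinearMap.range T) : T y = y := by
  obtain ⟨x, rfl⟩ := hy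
  exact hT.idem x

lemma IsCondExp.unit_mem : e ∈ LinearMap.range T := ⟨e, hT.map_unit⟩

lemma IsCondExp.isLUB_map {f : ℕ → E} (hf : Monotone f) {s : E} (hs : IsLUB (range f) s) :
    IsLUB (range fun n => T (f n)) (T s) := by
  have h := hT.orderContinuous (range fun n => s - f n) (range_nonempty _) (by
      rintro _ ⟨n, rfl⟩ _ ⟨m, rfl⟩
      exact ⟨_, ⟨max n m, rfl⟩, sub_le_sub_left (hf (le_max_left n m)) s,
        sub_le_sub_left (hf (le_max_right n m)) s⟩) (by
      refine ⟨?_, fun b hb => ?_⟩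
      · rintro _ ⟨n, rfl⟩
        exact sub_nonneg.2 (hs.1 (mem_range_self n))
      · have : s ≤ s - b := hs.2 (by
          rintro _ ⟨n, rfl⟩
          exact le_sub_comm.1 (hb (mem_range_self n)))
        simpa using this)
  refine ⟨?_, fun b hb => ?_⟩
  · rintro _ ⟨n, rfl⟩
    exact hT.mono (hs.1 (mem_range_self n))
  · have : T s - b ≤ 0 := h.2 (by
      rintro _ ⟨_, ⟨n, rfl⟩, rfl⟩
      rw [map_sub]
      exact sub_le_sub_left (hb (mem_range_self n)) _)
    exact sub_nonpos.1 this

/-- By order continuity `T s` is the supremum of the `T (f n) = f n`, so `T s = s`. Consequently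
spectral components of elements of the range stay in the range. -/
lemma IsCondExp.isSigmaClosed_range : IsSigmaClosed (LinearMap.range T) where
  sup_mem := hT.range_sup
  lub_mem f hf hfT s hs := by
    have h := hT.isLUB_map hf hs
    simp only [hT.map_eq_of_mem (hfT _)] at h
    exact ⟨s, h.unique hs⟩

variable (he : IsWeakOrderUnit e)
include he

/-- Since `T` fixes `d`, `T (x ⊓ n d) ≤ n d`, which vanishes where `d` does; order continuity passes
to the supremum over `n`. -/
lemma IsCondExp.val_map_bandProj_eq_zero {d : E} (hd0 : 0 ≤ d) (hd : d ∈ LinearMap.range T) {x : E}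
    (hx : 0 ≤ x) : ∀ᶠ F in generic E, val e F d = 0 → val e F (T (bandProj d x)) = 0 := by
  have h1 := val_isLUB he (hT.isLUB_map (monotone_inf_smul_abs x d) (isLUB_bandProj hx d))
  have h2 : ∀ᶠ F in generic E, ∀ n : ℕ, 0 ≤ val e F (T (x ⊓ (n : ℝ) • |d|)) ∧
      val e F (T (x ⊓ (n : ℝ) • |d|)) ≤ n * val e F d := by
    refine eventually_countable_forall.2 fun n => ?_
    have h3 : 0 ≤ x ⊓ (n : ℝ) • |d| := le_inf hx (smul_nonneg n.cast_nonneg (abs_nonneg d))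
    have h4 : T (x ⊓ (n : ℝ) • |d|) ≤ (n : ℝ) • d := by
      refine (hT.mono inf_le_right).trans ?_
      rw [abs_of_nonneg hd0, map_smul, hT.map_eq_of_mem hd]
    filter_upwards [val_nonneg he (hT.nonneg _ h3), val_mono he h4, val_smul he (n : ℝ) d]
      with F h5 h6 h7
    exact ⟨h5, h7 ▸ h6⟩
  filter_upwards [h1, h2] with F h1 h2 h0
  have h3 : ∀ n : ℕ, val e F (T (x ⊓ (n : ℝ) • |d|)) = 0 := fun n => by
    obtain ⟨h4, h5⟩ := h2 n
    rw [h0, mul_zero] at h5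
    exact le_antisymm h5 h4
  simp only [h3] at h1
  exact h1.unique (by simp)

/-- A conditional expectation commutes with multiplication by components in its range. -/
lemma IsCondExp.val_map_bandProj {d : E} (hdc : IsComponent e d) (hd : d ∈ LinearMap.range T)
    {x : E} (hx : 0 ≤ x) :
    ∀ᶠ F in generic E, val e F (T (bandProj d x)) = val e F d * val e F (T x) := by
  have hdv := (isComponent_iff_val he).1 hdc
  have hd0 : 0 ≤ d := nonneg_of_val he (hdv.mono fun F h => by rcases h with h | h <;> simp [h])
  have hde : 0 ≤ e - d := nonneg_of_val he (by
    filter_upwards [hdv, val_sub he e d] with F h h'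
    rw [h', val_unit he]
    rcases h with h | h <;> simp [h])
  -- Splitting `x` along `d` and `e - d`, both in the range, lets the previous vanishing statement
  -- be used on each side.
  have hadd : bandProj d x + bandProj (e - d) x = x := (eq_iff_val he).2 <| by
    filter_upwards [hdv, val_sub he e d, val_bandProj he d x, val_bandProj he (e - d) x,
      val_add he (bandProj d x) (bandProj (e - d) x)] with F h1 h2 h3 h4 h5
    rw [h5, h3, h4, h2, val_unit he]
    rcases h1 with h | h <;> simp [h]
  filter_upwards [hT.val_map_bandProj_eq_zero he hd0 hd hx,
    hT.val_map_bandProj_eq_zero he hde ((LinearMap.range T).sub_mem hT.unit_mem hd) hx, hdv,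
    val_sub he e d, val_add he (T (bandProj d x)) (T (bandProj (e - d) x))] with F h1 h2 h3 h4 h5
  rw [← map_add, hadd] at h5
  rcases h3 with h | h
  · rw [h1 h, h, zero_mul]
  · rw [h5, h2 (by rw [h4, h, val_unit he, sub_self]), h, add_zero, one_mul]

/-- The averaging property, for multiplication by a component. -/
lemma IsCondExp.val_map_mul {P : E →ₗ[ℝ] E} (hP : IsIndicatorOp e P) {y : E} (hy0 : 0 ≤ y)
    (hy : y ∈ LinearMap.range T) :
    ∀ᶠ F in generic E, val e F (T (P y)) = val e F (T (P e)) * val e F y := by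
  have hPb := hP.isBandProjection he
  have key : ∀ᶠ F in generic E, ∀ a b : ℚ, (a : ℝ) < val e F y → val e F y ≤ b →
      a * val e F (T (P e)) ≤ val e F (T (P y)) ∧ val e F (T (P y)) ≤ b * val e F (T (P e)) := by
    refine eventually_countable_forall.2 fun a => eventually_countable_forall.2 fun b => ?_
    rcases le_or_gt b a with hab | hab
    · refine Eventually.of_forall fun F h1 h2 => ?_
      have : (b : ℝ) ≤ a := by exact_mod_cast hab
      linarith
    replace hab : (a : ℝ) < b := by exact_mod_cast hab
    -- On the slice `a < y ≤ b`, which belongs to the range, `P y` lies between `a P e` and `b P e`.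
    -- Applying `T`, which commutes with multiplication by `d`, keeps these bounds where `d` has
    -- value `1`.
    set d := spectral e y b - spectral e y a with hd
    have hdv := val_spectral_sub he y hab
    rw [← hd] at hdv
    have hdc : IsComponent e d := (isComponent_iff_val he).2 (hdv.mono fun F hF => by
      rw [hF]; split_ifs <;> simp)
    have hdT : d ∈ LinearMap.range T := (LinearMap.range T).sub_mem
      (hT.isSigmaClosed_range.spectral_mem he.1 hT.unit_mem hy b)
      (hT.isSigmaClosed_range.spectral_mem he.1 hT.unit_mem hy a)
    have h1 : (a : ℝ) • bandProj d (P e) ≤ bandProj d (P y) := le_of_val_le he <| by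
      filter_upwards [hdv, val_bandProj he d (P e), val_bandProj he d (P y), hP y,
        val_smul he (a : ℝ) (bandProj d (P e))] with F h1 h2 h3 ⟨h4, h5⟩ h6
      rw [h6, h2, h3, h5, h1]
      by_cases h : (a : ℝ) < val e F y ∧ val e F y ≤ b
      · rcases h4 with h4 | h4 <;> simp [h, h4, h.1.le]
      · simp [h]
    have h2 : bandProj d (P y) ≤ (b : ℝ) • bandProj d (P e) := le_of_val_le he <| by
      filter_upwards [hdv, val_bandProj he d (P e), val_bandProj he d (P y), hP y,
        val_smul he (b : ℝ) (bandProj d (P e))] with F h1 h2 h3 ⟨h4, h5⟩ h6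
      rw [h6, h2, h3, h5, h1]
      by_cases h : (a : ℝ) < val e F y ∧ val e F y ≤ b
      · rcases h4 with h4 | h4 <;> simp [h, h4]
      · simp [h]
    have h1' := hT.mono h1
    have h2' := hT.mono h2
    rw [map_smul] at h1' h2'
    filter_upwards [hdv, val_mono he h1', val_mono he h2',
      hT.val_map_bandProj he hdc hdT (hPb.nonneg e he.1),
      hT.val_map_bandProj he hdc hdT (hPb.nonneg y hy0),
      val_smul he (a : ℝ) (T (bandProj d (P e))), val_smul he (b : ℝ) (T (bandProj d (P e)))]
      with F g1 g2 g3 g4 g5 g6 g7 ha hb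
    rw [if_pos ⟨ha, hb⟩] at g1
    rw [g6, g4, g5, g1, one_mul, one_mul] at g2
    rw [g7, g4, g5, g1, one_mul, one_mul] at g3
    exact ⟨g2, g3⟩
  filter_upwards [key, val_nonneg he (hT.nonneg _ (hPb.nonneg e he.1))] with F h1 h2
  exact eq_mul_of_forall_rat h2 h1

/-! ### Independence -/

/-- Each `T P_i` acts on a positive element of the range as multiplication by `T (P_i e)`.
Membership in the range and positivity are carried along so that averaging applies at the next
factor. -/
lemma IsCondExp.val_prod_map_mul_apply {ι : Type*} {P : ι → Module.End ℝ E}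
    (hP : ∀ i, IsIndicatorOp e (P i)) (l : List ι) :
    (l.map fun i => (T : Module.End ℝ E) * P i).prod e ∈ LinearMap.range T ∧
    0 ≤ (l.map fun i => (T : Module.End ℝ E) * P i).prod e ∧
    ∀ᶠ F in generic E, val e F ((l.map fun i => (T : Module.End ℝ E) * P i).prod e) =
      (l.map fun i => val e F (T (P i e))).prod := by
  induction l with
  | nil => exact ⟨by simpa using hT.unit_mem, by simpa using he.1,
      Eventually.of_forall fun F => by simp [val_unit he]⟩
  | cons i l ih =>
    obtain ⟨h1, h2, h3⟩ := ih
    simp only [List.map_cons, List.prod_cons, Module.End.mul_apply]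
    refine ⟨LinearMap.mem_range_self T _,
      hT.nonneg _ (((hP i).isBandProjection he).nonneg _ h2), ?_⟩
    filter_upwards [h3, hT.val_map_mul he (hP i) h2 h1] with F h3 h4
    rw [h4, h3]

lemma IsCondExp.projEq_mem_genSubspace (x : E) (t : ℝ) :
    projEqₗ he x t e ∈ genSubspace T x := by
  refine Submodule.mem_sInf.2 ?_
  rintro S ⟨hS, hxS, hTS⟩
  have heS : e ∈ S := hTS hT.unit_mem
  have hu := S.sub_mem hxS (S.smul_mem t heS)
  exact S.sub_mem heS (hS.isSigmaClosed.bandProj_mem he.1 heS (hS.1 _ hu _ (S.neg_mem hu)))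

/-- The joint mass function of a `T`-independent family. -/
lemma IsCondExp.val_map_joint {ι : Type*} {f : ι → E} (hf : ElemIndep e T f) (t : ι → ℝ)
    {l : List ι} (hl : l.Nodup) : ∀ᶠ F in generic E,
      val e F (T ((l.map fun i => (projEqₗ he (f i) (t i) : Module.End ℝ E)).prod e)) =
        (l.map fun i => val e F (massFn e T (f i) (t i))).prod := by
  have hP := fun i => isIndicatorOp_projEqₗ he (f i) (t i)
  rw [hf (fun i => projEqₗ he (f i) (t i)) (fun i => (hP i).isBandProjection he)
    (fun i => hT.projEq_mem_genSubspace he _ _) l hl]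
  exact (hT.val_prod_map_mul_apply he hP l).2.2

end condExp

/-! ### Increasing sequences and nonnegative series -/

lemma orderTendsto_of_monotone {f : ℕ → E} (hf : Monotone f) {s : E} (hs : IsLUB (range f) s) :
    OrderTendsto f s := by
  refine ⟨fun n => s - f n, fun n m h => sub_le_sub_left (hf h) s, ⟨?_, fun b hb => ?_⟩, fun n => ?_⟩
  · rintro _ ⟨n, rfl⟩
    exact sub_nonneg.2 (hs.1 (mem_range_self n))
  · have : s ≤ s - b := hs.2 (by
      rintro _ ⟨n, rfl⟩
      exact le_sub_comm.1 (hb (mem_range_self n)))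
    simpa using this
  · rw [abs_sub_comm, abs_of_nonneg (sub_nonneg.2 (hs.1 (mem_range_self n)))]

lemma isLUB_range_sum_of_hasSum {f : ℕ → ℝ} (hf : ∀ n, 0 ≤ f n) {a : ℝ} (h : HasSum f a) :
    IsLUB (range fun m => ∑ n ∈ Finset.range m, f n) a :=
  isLUB_of_tendsto_atTop (monotone_nat_of_le_succ fun m => by
    rw [Finset.sum_range_succ]; exact le_add_of_nonneg_right (hf m)) h.tendsto_sum_nat

section

variable {T : E →ₗ[ℝ] E} (hT : IsCondExp e T) (he : IsWeakOrderUnit e)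
include hT he

/-! ### Distributions at a point -/

/-- The masses at `1` and `0` add up to `e`, so `T` kills the component on which `x` takes neither
value; strict positivity makes that component zero. -/
lemma IsCondExp.val_bernoulli {x p : E} (hx : IsBernoulli e T x p) :
    ∀ᶠ F in generic E, val e F x = 0 ∨ val e F x = 1 := by
  obtain ⟨-, -, h1, h0⟩ := hx
  have hz : ∀ᶠ F in generic E, val e F (e - projEq x ((1 : ℝ) • e) e - projEq x ((0 : ℝ) • e) e) =
      1 - (if val e F x = 1 then 1 else 0) - if val e F x = 0 then 1 else 0 := by
    filter_upwards [val_projEq he x 1 e, val_projEq he x 0 e,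
      val_sub he e (projEq x ((1 : ℝ) • e) e),
      val_sub he (e - projEq x ((1 : ℝ) • e) e) (projEq x ((0 : ℝ) • e) e)] with F g1 g2 g3 g4
    rw [g4, g3, g1, g2, val_unit he]
  have hz0 : e - projEq x ((1 : ℝ) • e) e - projEq x ((0 : ℝ) • e) e = 0 := by
    refine hT.eq_zero_of_map (nonneg_of_val he (hz.mono fun F hF => ?_)) ?_
    · rw [hF]
      split_ifs with g1 g2
      · exact absurd (g1.symm.trans g2) one_ne_zero
      all_goals norm_num
    · rw [map_sub, map_sub, hT.map_unit]
      change e - massFn e T x 1 - massFn e T x 0 = 0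
      rw [h1, h0, sub_self]
  filter_upwards [hz] with F hF
  rw [hz0, val_zero he] at hF
  by_contra! hne
  simp [hne.1, hne.2] at hF

omit hT in
lemma val_poisson {x g : E} (hx : IsPoisson e T x g) : ∀ᶠ F in generic E, ∀ k : ℕ,
    val e F (massFn e T x k) =
      ((k.factorial : ℝ)⁻¹) * (Real.exp (-val e F g) * val e F g ^ k) := by
  obtain ⟨hg, h, hh, hw⟩ := hx
  have hhv := (isFunCalc_iff_val he (by fun_prop) fun t => (Real.exp_pos _).le).1 hh
  refine eventually_countable_forall.2 fun k => ?_
  obtain ⟨w, hw, hm⟩ := hw k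
  filter_upwards [hhv, (isPosProd_iff_val he hw.1).1 hw, val_smul he ((k.factorial : ℝ)⁻¹) w]
    with F h1 h2 h3
  rw [hm, h3, h2, Fin.prod_univ_succ]
  simp [h1]

omit hT in
/-- An element is Poisson distributed as soon as its mass function has the right values. -/
lemma isPoisson_of_val {x g : E} (hg : 0 ≤ g) (h : ∀ k : ℕ, ∀ᶠ F in generic E,
    val e F (massFn e T x k) =
      ((k.factorial : ℝ)⁻¹) * (Real.exp (-val e F g) * val e F g ^ k)) : IsPoisson e T x g := by
  have hexp : ∀ t : ℝ, 0 ≤ Real.exp (-t) := fun t => (Real.exp_pos _).le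
  obtain ⟨w, hw⟩ := exists_isFunCalc he (f := fun t => Real.exp (-t)) (by fun_prop) hexp
    -- Since `g ≥ 0`, `exp (-g)` is dominated by `e`, so it exists in `E`.
    (x := g) (b := e) (by
      filter_upwards [val_nonneg he hg] with F hF
      rw [val_unit he]
      exact Real.exp_le_one_iff.2 (by linarith))
  have hwv := (isFunCalc_iff_val he (f := fun t => Real.exp (-t)) (by fun_prop) hexp).1 hw
  have hw0 : 0 ≤ w := nonneg_of_val he (hwv.mono fun F hF => hF ▸ hexp _)
  refine ⟨hg, w, hw, fun k => ⟨(k.factorial : ℝ) • massFn e T x k, ?_, ?_⟩⟩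
  · refine (isPosProd_iff_val he (Fin.cases hw0 fun _ => hg)).2 ?_
    filter_upwards [h k, hwv, val_smul he (k.factorial : ℝ) (massFn e T x k)] with F h1 h2 h3
    rw [h3, h1, mul_inv_cancel_left₀ (by positivity), Fin.prod_univ_succ]
    simp [h2]
  · rw [inv_smul_smul₀ (by positivity)]

/-- The Poisson masses sum to `1`, so the supremum `z` of the events `N ∈ {0, …, m - 1}` satisfies
`T z = e`, and strict positivity gives `z = e`. A generic point with `N` outside `ℕ` would give `z`
the value `0`. -/
lemma IsCondExp.val_poisson_mem_nat {N g : E} (hN : IsPoisson e T N g) :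
    ∀ᶠ F in generic E, ∃ n : ℕ, val e F N = n := by
  have hq : ∀ᶠ F in generic E, ∀ n : ℕ, val e F (projEq N ((n : ℝ) • e) e) =
      if val e F N = n then 1 else 0 := by
    refine eventually_countable_forall.2 fun n => ?_
    filter_upwards [val_projEq he N n e] with F hF
    rw [hF, val_unit he]
  have hq0 : ∀ n : ℕ, 0 ≤ projEq N ((n : ℝ) • e) e := fun n => nonneg_of_val he (by
    filter_upwards [hq] with F hF
    rw [hF]
    split_ifs <;> simp)
  set f : ℕ → E := fun m => ∑ n ∈ Finset.range m, projEq N ((n : ℝ) • e) e with hf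
  have hmono : Monotone f := monotone_nat_of_le_succ fun m => by
    simp only [hf, Finset.sum_range_succ]
    exact le_add_of_nonneg_right (hq0 m)
  have hfv : ∀ᶠ F in generic E, ∀ m, val e F (f m) =
      ∑ n ∈ Finset.range m, if val e F N = n then 1 else 0 := by
    have : ∀ᶠ F in generic E, ∀ m, val e F (f m) =
        ∑ n ∈ Finset.range m, val e F (projEq N ((n : ℝ) • e) e) :=
      eventually_countable_forall.2 fun m => val_sum he _ _
    filter_upwards [this, hq] with F h1 h2 m
    rw [h1]
    exact Finset.sum_congr rfl fun n _ => h2 n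
  have hbound : ∀ m, f m ≤ e := fun m => le_of_val_le he <| by
    filter_upwards [hfv] with F h1
    rw [h1, val_unit he]
    by_cases h : ∃ k : ℕ, val e F N = k
    · obtain ⟨k, hk⟩ := h
      simp only [hk, Nat.cast_inj, Finset.sum_ite_eq]
      split_ifs <;> simp
    · push Not at h
      simp [h]
  have hz := isLUB_ciSup (f := f) ⟨e, by rintro _ ⟨m, rfl⟩; exact hbound m⟩
  set z := ⨆ m, f m
  have hTz : T z = e := (eq_iff_val he).2 <| by
    have h1 : ∀ᶠ F in generic E, ∀ m, val e F (T (f m)) =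
        ∑ n ∈ Finset.range m, val e F (massFn e T N n) := by
      refine eventually_countable_forall.2 fun m => ?_
      rw [hf, map_sum]
      exact val_sum he _ _
    filter_upwards [h1, val_isLUB he (hT.isLUB_map hmono hz), val_poisson he hN,
      val_nonneg he hN.1] with F h1 h2 h3 h4
    simp only [h1, h3] at h2
    rw [val_unit he]
    exact h2.unique (isLUB_range_sum_of_hasSum (fun n => by positivity) (hasSum_poisson _))
  have hze : z = e := by
    have : e - z = 0 := hT.eq_zero_of_map (sub_nonneg.2 (ciSup_le hbound)) (by
      rw [map_sub, hTz, hT.map_unit, sub_self])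
    exact (sub_eq_zero.1 this).symm
  filter_upwards [hfv, val_isLUB he hz] with F h1 h2
  by_contra! h3
  simp only [h1, h3, if_false, Finset.sum_const_zero] at h2
  rw [hze, val_unit he] at h2
  exact zero_ne_one ((show IsLUB (range fun _ : ℕ => (0 : ℝ)) 0 by simp).unique h2)

/-! ### Random sums -/

omit hT in
-- Where `N = k`, the partial sums of the series are `0` up to index `k` and equal to `S_k ≤ k`
-- afterwards. They therefore increase and are bounded by `N`, which yields order convergence in
-- `E`.
lemma exists_isRandomSum {N : E} {x : ℕ → E} (hN : ∀ᶠ F in generic E, ∃ n : ℕ, val e F N = n)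
    (hx : ∀ i, ∀ᶠ F in generic E, val e F (x i) = 0 ∨ val e F (x i) = 1) :
    ∃ S, IsRandomSum e N x S ∧ ∀ᶠ F in generic E, ∀ n : ℕ, val e F N = n →
      val e F S = ∑ i ∈ Finset.range n, val e F (x i) := by
  have hx' : ∀ᶠ F in generic E, ∀ i, val e F (x i) = 0 ∨ val e F (x i) = 1 :=
    eventually_countable_forall.2 hx
  set f : ℕ → E := fun m =>
    ∑ n ∈ Finset.range m, projEq N ((n : ℝ) • e) (∑ i ∈ Finset.range n, x i) with hf
  have hterm : ∀ᶠ F in generic E, ∀ n : ℕ,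
      val e F (projEq N ((n : ℝ) • e) (∑ i ∈ Finset.range n, x i)) =
        if val e F N = n then ∑ i ∈ Finset.range n, val e F (x i) else 0 := by
    refine eventually_countable_forall.2 fun n => ?_
    filter_upwards [val_projEq he N n (∑ i ∈ Finset.range n, x i),
      val_sum he (Finset.range n) x] with F h1 h2
    rw [h1, h2]
  have hfv : ∀ᶠ F in generic E, ∀ m (k : ℕ), val e F N = k → val e F (f m) =
      if k < m then ∑ i ∈ Finset.range k, val e F (x i) else 0 := by
    have : ∀ᶠ F in generic E, ∀ m, val e F (f m) = ∑ n ∈ Finset.range m,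
        val e F (projEq N ((n : ℝ) • e) (∑ i ∈ Finset.range n, x i)) :=
      eventually_countable_forall.2 fun m => val_sum he _ _
    filter_upwards [this, hterm] with F h1 h2 m k hk
    rw [h1, Finset.sum_congr rfl fun n _ => h2 n]
    simp only [hk, Nat.cast_inj, Finset.sum_ite_eq, Finset.mem_range]
  have hpos : ∀ᶠ F in generic E, ∀ n, 0 ≤ ∑ i ∈ Finset.range n, val e F (x i) ∧
      ∑ i ∈ Finset.range n, val e F (x i) ≤ n := by
    filter_upwards [hx'] with F h1 n
    refine ⟨Finset.sum_nonneg fun i _ => by rcases h1 i with h | h <;> simp [h], ?_⟩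
    calc ∑ i ∈ Finset.range n, val e F (x i) ≤ ∑ i ∈ Finset.range n, (1 : ℝ) :=
          Finset.sum_le_sum fun i _ => by rcases h1 i with h | h <;> simp [h]
      _ = n := by simp
  have hmono : Monotone f := monotone_nat_of_le_succ fun m => le_of_val_le he <| by
    filter_upwards [hfv, hpos, hN] with F h1 h2 ⟨k, hk⟩
    rw [h1 m k hk, h1 (m + 1) k hk]
    split_ifs with g1 g2 g2
    · exact le_rfl
    · omega
    · exact (h2 k).1
    · exact le_rfl
  have hbdd : BddAbove (range f) := ⟨N, by
    rintro _ ⟨m, rfl⟩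
    refine le_of_val_le he ?_
    filter_upwards [hfv, hpos, hN] with F h1 h2 ⟨k, hk⟩
    rw [h1 m k hk, hk]
    split_ifs
    · exact (h2 k).2
    · positivity⟩
  refine ⟨⨆ m, f m, orderTendsto_of_monotone hmono (isLUB_ciSup hbdd), ?_⟩
  filter_upwards [hfv, hpos, val_isLUB he (isLUB_ciSup hbdd)] with F h1 h2 h3 k hk
  simp only [h1 _ k hk] at h3
  refine h3.unique ⟨?_, fun b hb => ?_⟩
  · rintro _ ⟨m, rfl⟩
    dsimp only
    split_ifs
    · exact le_rfl
    · exact (h2 k).1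
  · have := hb (mem_range_self (k + 1))
    simpa using this

/-- Conditioning on `N`: the event `S = k` is the disjoint union of the events `N = n, S_n = k`,
each of which has binomial probability given `N = n`. Order continuity takes `T` through the union
over `n`. -/
lemma IsCondExp.massFn_randomSum {N : E} {x : ℕ → E} {p S : E}
    (hindep : ElemIndep e T (fun i : Option ℕ => i.elim N x))
    (hx : ∀ i, IsBernoulli e T (x i) p) (hN : ∀ᶠ F in generic E, ∃ n : ℕ, val e F N = n)
    (hS : ∀ᶠ F in generic E, ∀ n : ℕ, val e F N = n →
      val e F S = ∑ i ∈ Finset.range n, val e F (x i)) (k : ℕ) :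
    ∀ᶠ F in generic E, IsLUB (range fun m => ∑ n ∈ Finset.range m,
      (n.choose k : ℝ) * (val e F p ^ k * (1 - val e F p) ^ (n - k)) * val e F (massFn e T N n))
      (val e F (massFn e T S k)) := by
  have hx' : ∀ᶠ F in generic E, ∀ i, val e F (x i) = 0 ∨ val e F (x i) = 1 :=
    eventually_countable_forall.2 fun i => hT.val_bernoulli he (hx i)
  -- The event that `N = n` and that, among the first `n` trials, exactly those in `A` succeed; the
  -- index `none` stands for `N`. Summing over `A` gives `b n`, the event `N = n, S_n = k`.
  set r : ℕ → Finset ℕ → E := fun n A =>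
    ((none :: (List.range n).map some).map fun i : Option ℕ =>
      (projEqₗ he (i.elim N x) (i.elim (n : ℝ) fun i => if i ∈ A then 1 else 0) :
        Module.End ℝ E)).prod e with hr
  set b : ℕ → E := fun n => ∑ A ∈ Finset.powersetCard k (Finset.range n), r n A with hb
  have hnodup : ∀ n, (none :: (List.range n).map some : List (Option ℕ)).Nodup := fun n =>
    List.nodup_cons.2 ⟨by simp, (List.nodup_range).map (Option.some_injective _)⟩
  have hrv : ∀ᶠ F in generic E, ∀ n A, val e F (r n A) = (if val e F N = n then 1 else 0) *
      ∏ i ∈ Finset.range n, if val e F (x i) = (if i ∈ A then 1 else 0) then 1 else 0 := by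
    refine eventually_countable_forall.2 fun n => eventually_countable_forall.2 fun A => ?_
    have h1 : ∀ᶠ F in generic E, ∀ i : Option ℕ,
        val e F (projEqₗ he (i.elim N x) (i.elim (n : ℝ) fun i => if i ∈ A then 1 else 0) e) =
        if val e F (i.elim N x) = (i.elim (n : ℝ) fun i => if i ∈ A then 1 else 0)
          then 1 else 0 := by
      refine eventually_countable_forall.2 fun i => ?_
      filter_upwards [val_projEq he (i.elim N x)
        (i.elim (n : ℝ) fun i => if i ∈ A then 1 else 0) e] with F hF
      rw [projEqₗ_apply, hF, val_unit he]
    filter_upwards [h1, val_prod_map_apply he (fun i : Option ℕ => isIndicatorOp_projEqₗ he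
      (i.elim N x) (i.elim (n : ℝ) fun i => if i ∈ A then 1 else 0))
      (none :: (List.range n).map some)] with F h1 h2
    rw [h2, List.map_congr_left fun i _ => h1 i]
    simp only [List.map_cons, List.prod_cons, List.map_map, Function.comp_def, Option.elim,
      list_prod_map_range]
    congr!
  have hbv : ∀ᶠ F in generic E, ∀ n, val e F (b n) = if val e F N = n ∧
      ∑ i ∈ Finset.range n, val e F (x i) = k then 1 else 0 := by
    have : ∀ᶠ F in generic E, ∀ n, val e F (b n) =
        ∑ A ∈ Finset.powersetCard k (Finset.range n), val e F (r n A) :=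
      eventually_countable_forall.2 fun n => val_sum he _ _
    filter_upwards [this, hrv, hx'] with F h1 h2 h3 n
    rw [h1, Finset.sum_congr rfl fun A _ => h2 n A, ← Finset.mul_sum,
      sum_powersetCard_prod_ite h3]
    by_cases hA : val e F N = n <;> simp [hA]
  have hb0 : ∀ n, 0 ≤ b n := fun n => nonneg_of_val he (by
    filter_upwards [hbv] with F hF
    rw [hF]
    split_ifs <;> simp)
  have hTr : ∀ᶠ F in generic E, ∀ n, ∀ A ∈ Finset.powersetCard k (Finset.range n),
      val e F (T (r n A)) =
        val e F (massFn e T N n) * (val e F p ^ k * (1 - val e F p) ^ (n - k)) := by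
    refine eventually_countable_forall.2 fun n => eventually_countable_forall.2 fun A => ?_
    filter_upwards [hT.val_map_joint he hindep
      (fun i : Option ℕ => i.elim (n : ℝ) fun i => if i ∈ A then 1 else 0) (hnodup n),
      val_sub he e p] with F h1 h2 hA
    obtain ⟨hA1, hA2⟩ := Finset.mem_powersetCard.1 hA
    have h3 : ∀ i, val e F (massFn e T (x i) (if i ∈ A then 1 else 0)) =
        if i ∈ A then val e F p else 1 - val e F p := fun i => by
      split_ifs
      · rw [(hx i).2.2.1]
      · rw [(hx i).2.2.2, h2, val_unit he]
    have h4 : ∏ i ∈ Finset.range n, (if i ∈ A then val e F p else 1 - val e F p) =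
        val e F p ^ k * (1 - val e F p) ^ (n - k) := by
      rw [Finset.prod_ite, Finset.prod_const, Finset.prod_const,
        Finset.filter_mem_eq_inter, Finset.inter_eq_right.2 hA1, hA2,
        Finset.filter_notMem_eq_sdiff, Finset.card_sdiff_of_subset hA1, hA2, Finset.card_range]
    rw [hr, h1, List.map_cons, List.prod_cons, List.map_map, ← h4]
    simp only [Option.elim, Function.comp_def, h3, list_prod_map_range]
  have hTb : ∀ᶠ F in generic E, ∀ n, val e F (T (b n)) =
      (n.choose k : ℝ) * (val e F p ^ k * (1 - val e F p) ^ (n - k)) *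
        val e F (massFn e T N n) := by
    have : ∀ᶠ F in generic E, ∀ n, val e F (T (b n)) =
        ∑ A ∈ Finset.powersetCard k (Finset.range n), val e F (T (r n A)) := by
      refine eventually_countable_forall.2 fun n => ?_
      rw [hb, map_sum]
      exact val_sum he _ _
    filter_upwards [this, hTr] with F h1 h2 n
    rw [h1, Finset.sum_congr rfl (h2 n), Finset.sum_const, Finset.card_powersetCard,
      Finset.card_range, nsmul_eq_mul]
    ring
  have hmono : Monotone fun m => ∑ n ∈ Finset.range m, b n := monotone_nat_of_le_succ fun m => by
    rw [Finset.sum_range_succ]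
    exact le_add_of_nonneg_right (hb0 m)
  have hlub : IsLUB (range fun m => ∑ n ∈ Finset.range m, b n) (projEq S ((k : ℝ) • e) e) := by
    refine isLUB_of_val he ?_
    have : ∀ᶠ F in generic E, ∀ m, val e F (∑ n ∈ Finset.range m, b n) =
        ∑ n ∈ Finset.range m, val e F (b n) :=
      eventually_countable_forall.2 fun m => val_sum he _ _
    filter_upwards [this, hbv, hN, hS, val_projEq he S k e] with F h1 h2 ⟨j, hj⟩ h3 h4
    have h5 : ∀ m, val e F (∑ n ∈ Finset.range m, b n) =
        if j < m then (if val e F S = k then 1 else 0) else 0 := fun m => by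
      rw [h1, Finset.sum_congr rfl fun n _ => h2 n, h3 j hj]
      simp only [hj, Nat.cast_inj, ite_and, Finset.sum_ite_eq, Finset.mem_range]
    simp only [h5]
    rw [h4, val_unit he]
    refine ⟨?_, fun c hc => ?_⟩
    · rintro _ ⟨m, rfl⟩
      dsimp only
      split_ifs <;> simp
    -- Where `N = j`, the only term that can be nonzero has index `j`, and it first enters in the
    -- partial sum of length `j + 1`.
    · simpa using hc (mem_range_self (j + 1))
  have hTsum : ∀ᶠ F in generic E, ∀ m, val e F (T (∑ n ∈ Finset.range m, b n)) =
      ∑ n ∈ Finset.range m, val e F (T (b n)) := by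
    refine eventually_countable_forall.2 fun m => ?_
    rw [map_sum]
    exact val_sum he _ _
  filter_upwards [val_isLUB he (hT.isLUB_map hmono hlub), hTsum, hTb] with F h1 h2 h3
  simp only [h2, h3] at h1
  exact h1

end

end RieszProb

end

/-! ### The thinning theorem -/

theorem mainTheorem8 {E : Type*} [ConditionallyCompleteLattice E] [AddCommGroup E]
    [IsOrderedAddMonoid E] [Module ℝ E] [IsOrderedModule ℝ E]
    (e : E) (T : E →ₗ[ℝ] E) (hT : RieszProb.IsCondRieszTriple e T)
    (N : E) (x : ℕ → E) (g p : E)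
    (hN : RieszProb.IsPoisson e T N g)
    (hx : ∀ i, RieszProb.IsBernoulli e T (x i) p)
    (hindep : RieszProb.ElemIndep e T (fun i : Option ℕ => i.elim N x)) :
    ∃ S pg : E, RieszProb.IsRandomSum e N x S ∧ RieszProb.IsPosProd e ![p, g] pg ∧
      RieszProb.IsPoisson e T S pg := by
  obtain ⟨he, hT⟩ := hT
  have hg : 0 ≤ g := hN.1
  have hp0 : 0 ≤ p := (hx 0).1.le
  have hp1 : p ≤ e := (hx 0).2.1.le
  have hNv := hT.val_poisson_mem_nat he hN
  obtain ⟨S, hS, hSv⟩ := RieszProb.exists_isRandomSum he hNv fun i => hT.val_bernoulli he (hx i)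
  have hu : ∀ i, 0 ≤ ![p, g] i := Fin.forall_fin_two.2 ⟨hp0, hg⟩
  -- Because `p ≤ e`, the product is dominated by `g` and hence lies in `E`.
  obtain ⟨pg, hpg⟩ := RieszProb.exists_isPosProd he hu (b := g) (by
    filter_upwards [RieszProb.val_mono he hp1, RieszProb.val_nonneg he hg] with F h1 h2
    rw [RieszProb.val_unit he] at h1
    simpa [Fin.prod_univ_two] using mul_le_of_le_one_left h2 h1)
  have hpgv := (RieszProb.isPosProd_iff_val he hu).1 hpg
  refine ⟨S, pg, hS, hpg, RieszProb.isPoisson_of_val he (RieszProb.nonneg_of_val he ?_)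
    fun k => ?_⟩
  · filter_upwards [hpgv, RieszProb.val_nonneg he hp0, RieszProb.val_nonneg he hg] with F h1 h2 h3
    rw [h1]
    simpa [Fin.prod_univ_two] using mul_nonneg h2 h3
  · filter_upwards [hpgv, hT.massFn_randomSum he hindep hx hNv hSv k,
      RieszProb.val_poisson he hN, RieszProb.val_nonneg he hp0, RieszProb.val_nonneg he hg,
      RieszProb.val_mono he hp1] with F h1 h2 h3 h4 h5 h6
    rw [RieszProb.val_unit he] at h6
    simp only [h3] at h2
    simp only [Fin.prod_univ_two, Matrix.cons_val_zero, Matrix.cons_val_one] at h1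
    rw [h1]
    refine h2.unique (RieszProb.isLUB_range_sum_of_hasSum (fun n => ?_)
      (RieszProb.hasSum_thinned_poisson _ _ k))
    have := sub_nonneg.2 h6
    positivity
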